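/- Let $\bar{\mathbb Z}=\mathbb Z\setminus\{0\}$ and let $\mathbb P$ be the product, over $j\in\bar{\mathbb Z}$, of the normalised Lebesgue measures $|j|\,\mathrm{mea}$ on $[0,\frac1{|j|}]$; it is a probability measure on the box $\Pi=\prod_{j\in\bar{\mathbb Z}}[0,\frac1{|j|}]$. For $v\ge 0$ put $J_v=\{j\in\bar{\mathbb Z}:|j|\le v\}$, $\tau_v=10v+10$, $\iota_v=2^{v^2}$, $\rho_v=\rho_0\bigl(1-\sum_{i=1}^v\frac1{10i^2}\bigr)$, $\epsilon_{v+1}=\epsilon_v^{5/4}$, and, for exponents $A,B>0$ and with $0^0=1$, $$\alpha_v^i=\frac{9+2^{-v}}{10}\,\frac1{(i^i)^{A}},\qquad \beta_v=\frac1{(v^v)^{B}}.$$ *Frequencies at step $v$.* Let $\omega_j(\sigma)$ $(j\in J_v)$ and $\Omega_j(x,\sigma)$ $(j\in\bar{\mathbb Z}\setminus J_v)$ be real, where $x\in\mathbb T^{J_v}=(\mathbb R/2\pi\mathbb Z)^{J_v}$ and $\sigma\in\Pi$. Assume that $\lambda=(\omega,\Omega)$ satisfies $$\lambda_n=n^2+\sigma_n+n\bar\lambda+\tilde\lambda+\hat\lambda_n\qquad(n\in\bar{\mathbb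 Z})$$ on $\mathbb T^{J_v}\times\Pi$, where $\bar\lambda,\tilde\lambda$ (independent of $n$) and $\hat\lambda_n$ are functions of $(x,\sigma)$, continuous in $x$ and partially differentiable in each $\sigma_l$ (one-sidedly at the ends of $[0,\frac1{|l|}]$), such that for all $n,l\in\bar{\mathbb Z}$, with $\|f\|=\sup_{\mathbb T^{J_v}\times\Pi}|f|$ and $\|f\|_L=\|f\|+\sup_{l\in\bar{\mathbb Z}}\|l\,\partial f/\partial\sigma_l\|$, $$\|\bar\lambda\|_L,\ \|\tilde\lambda\|_L\le\sum_{i=0}^v\epsilon_i,\qquad \|\hat\lambda_n\|\le\sum_{i=0}^v\epsilon_i|n|^{-1},\qquad \Bigl\|\frac{\partial\hat\lambda_n}{\partial\sigma_l}\Bigr\|\le\sum_{i=0}^v\epsilon_i\bigl(|nl|^{-1}+e^{-2|n-l|\rho_i}+e^{-2|n+l|\rho_i}\bigr).$$ Let $\bar\Omega_j(\sigma)$ be the average of $\Omega_j(\cdot,\sigma)$ over $\mathbb T^{J_v}$. *Resonance sets.* For $k\in\mathbb Z^{J_v}$ and finitely supported $l\in\mathbb Z^{\bar{\mathbb Z}\setminus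 J_v}$ let $|k|=\sum|k_j|$, $|l|=\sum|l_j|$, $\langle k\rangle=\max\{1,|k|\}$, $\langle l\rangle_2=\max\{1,|\sum j^2l_j|\}$. Call $(k,l)$ conserving if $\sum_jjk_j+\sum_jjl_j=0$ (momentum) and $\sum_jk_j+\sum_jl_j=0$ (mass). Let $\sigma_{k,\alpha,\tau}$ have the entries $\sigma_j$ for $|j|<\langle k\rangle^{2\tau+2}/\alpha^2$ and $0$ otherwise. Given a set $S\subseteq\Pi$ (the parameters left after the previous step), put $$\tilde R_{kl}(\alpha,\tau)=\Bigl\{\sigma\in S:\bigl|\langle k,\omega(\sigma_{k,\alpha,\tau})\rangle+\langle l,\bar\Omega(\sigma_{k,\alpha,\tau})\rangle\bigr|<2\alpha\frac{\langle l\rangle_2}{\langle k\rangle^{\tau}}\Bigr\}.$$ Regarding $\mathbb Z^{J_i}\subseteq\mathbb Z^{J_v}$ (extension by zero), let $$\Pi_v^{R,1}=\bigcup_{0\le i\le v}\ \bigcup_{k\in\mathbb Z^{J_i},\,|k|>\iota_v,\,(k,0)\text{ conserving}}\tilde R_{k0}(\alpha_v^i,\tau_i),\qquad \Pi_v^{R,2}=\bigcup_{0\ne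 k\in\mathbb Z^{J_v},\ 0\le|l|\le2,\,(k,l)\text{ conserving}}\tilde R_{kl}(\beta_v,\tau_v).$$ *Claim.* There is an absolute constant $C>0$ such that for every $\rho_0>0$ there is $\epsilon_{\max}>0$ such that for all $0<\epsilon_0\le\epsilon_{\max}$, all $A,B>0$, all $v\ge0$, all frequencies as above and all $S\subseteq\Pi$, $$\mathbb P(\Pi_v^{R,1})\le\frac1{\iota_v}\sum_{i=1}^v(i^i)^{C}\alpha_v^i,\qquad \mathbb P(\Pi_v^{R,2})\le(v^v)^{C}\beta_v,$$ where $\mathbb P$ of a set that is not known to be measurable is its outer measure. -/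

import Mathlib

open MeasureTheory
open scoped ENNReal

namespace DNLS

noncomputable section

/-- The index set of nonzero integers. -/
abbrev ZBar : Type := {n : ℤ // n ≠ 0}

/-- Sequences of parameters `σ = (σ_j)`, indexed by the nonzero integers. -/
abbrev Param : Type := ZBar → ℝ

/-- The interval `[0, 1/|j|]`. -/
def cell (j : ZBar) : Set ℝ := Set.Icc 0 (1 / |((j : ℤ) : ℝ)|)

/-- The parameter box `∏_j [0, 1/|j|]`. -/
def paramBox : Set Param := {σ | ∀ j, σ j ∈ cell j}

/-- The normalised Lebesgue measure `|j| · mea` on `[0, 1/|j|]`, as a measure on `ℝ`. -/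
def cellMeasure (j : ZBar) : Measure ℝ :=
  ENNReal.ofReal |((j : ℤ) : ℝ)| • volume.restrict (cell j)

instance cellMeasure_isProbabilityMeasure (j : ZBar) : IsProbabilityMeasure (cellMeasure j) := by
  constructor
  have hj : (0 : ℝ) < |((j : ℤ) : ℝ)| := abs_pos.mpr (Int.cast_ne_zero.mpr j.2)
  simp only [cellMeasure, cell, Measure.smul_apply, Measure.restrict_apply MeasurableSet.univ,
    Set.univ_inter, Real.volume_Icc, sub_zero, smul_eq_mul]
  rw [← ENNReal.ofReal_mul hj.le, mul_one_div_cancel hj.ne', ENNReal.ofReal_one]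

/-- The infinite product `ℙ` of the normalised Lebesgue measures on the intervals `[0, 1/|j|]`. -/
def prodMeasure : Measure Param := Measure.infinitePi cellMeasure

/-- The tangential sites `J_v = {j ≠ 0 : |j| ≤ v}`. -/
def sites (v : ℕ) : Finset ZBar := (Finset.Icc (-(v : ℤ)) (v : ℤ)).subtype (fun n => n ≠ 0)

/-- Tangential indices, as a type. -/
abbrev Tan (v : ℕ) : Type := {j : ZBar // j ∈ sites v}

/-- Normal indices, as a type. -/
abbrev Nor (v : ℕ) : Type := {j : ZBar // j ∉ sites v}

/-- The integer underlying a normal index, as a real number. -/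
def norVal {v : ℕ} (j : Nor v) : ℝ := (((j : ZBar) : ℤ) : ℝ)

instance twoPiPos : Fact (0 < 2 * Real.pi) := ⟨Real.two_pi_pos⟩

/-- The torus of angles `(ℝ / 2πℤ)^{J_v}`. -/
abbrev Torus (v : ℕ) : Type := Tan v → AddCircle (2 * Real.pi)

/-- The frequencies of a normal form `∑ ω_j(σ) y_j + ∑ Ω_j(x, σ) z_j z̄_j` at step `v`: the
tangential ones depend on the parameter, the normal ones on the angles and the parameter. -/
structure Frequencies (v : ℕ) where
  ω : Tan v → Param → ℝ
  Ω : Nor v → Torus v → Param → ℝ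

/-- The joint frequency vector `(ω, Ω)`, indexed by all nonzero integers. -/
def Frequencies.lam {v : ℕ} (F : Frequencies v) (n : ZBar) (x : Torus v) (σ : Param) : ℝ :=
  if h : n ∈ sites v then F.ω ⟨n, h⟩ σ else F.Ω ⟨n, h⟩ x σ

/-- The average of a normal frequency over the angles. -/
def Frequencies.avgΩ {v : ℕ} (F : Frequencies v) (j : Nor v) (σ : Param) : ℝ :=
  ⨍ x, F.Ω j x σ

/-- The sup-norm of a function of angles and parameters, over the torus times the box. -/
def supNorm {v : ℕ} (f : Torus v → Param → ℝ) : ℝ≥0∞ :=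
  ⨆ x, ⨆ σ ∈ paramBox, ENNReal.ofReal |f x σ|

/-- The partial derivative in the parameter `σ_l` (one-sided at the ends of `[0, 1/|l|]`). -/
def parDeriv {v : ℕ} (l : ZBar) (f : Torus v → Param → ℝ) (x : Torus v) (σ : Param) : ℝ :=
  derivWithin (fun s => f x (Function.update σ l s)) (cell l) (σ l)

/-- The function has all partial derivatives in the parameters, on the whole box. -/
def ParDifferentiable {v : ℕ} (f : Torus v → Param → ℝ) : Prop :=
  ∀ l x, ∀ σ ∈ paramBox,
    DifferentiableWithinAt ℝ (fun s => f x (Function.update σ l s)) (cell l) (σ l)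

/-- The norm `sup |f| + sup_l sup |l ∂f/∂σ_l|`. -/
def supDerivNorm {v : ℕ} (f : Torus v → Param → ℝ) : ℝ≥0∞ :=
  supNorm f + ⨆ l : ZBar, supNorm (fun x σ => ((l : ℤ) : ℝ) * parDeriv l f x σ)

/-- The sizes of the perturbations: `ε_{v+1} = ε_v^{5/4}`. -/
def eps (ε₀ : ℝ) : ℕ → ℝ
  | 0 => ε₀
  | v + 1 => (eps ε₀ v) ^ (5 / 4 : ℝ)

/-- The decay rates `ρ_v = ρ₀ (1 - ∑_{1 ≤ i ≤ v} 1 / (10 i²))`. -/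
def rho (ρ₀ : ℝ) (v : ℕ) : ℝ := ρ₀ * (1 - ∑ i ∈ Finset.Icc 1 v, 1 / (10 * (i : ℝ) ^ 2))

/-- The angle- and parameter-functions to which the asymptotic estimates apply: continuous in the
angles and partially differentiable in the parameters. -/
def Admissible {v : ℕ} (f : Torus v → Param → ℝ) : Prop :=
  (∀ σ ∈ paramBox, Continuous (fun x => f x σ)) ∧ ParDifferentiable f

/-- The asymptotic expansion `λ_n = n² + σ_n + n λ̄ + λ̃ + λ̂_n` of the frequencies at step `v`,
with the estimates on `λ̄`, `λ̃` (which do not depend on `n`) and on `λ̂_n`. -/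
def Frequencies.HasAsymptotics {v : ℕ} (F : Frequencies v) (ε₀ ρ₀ : ℝ) : Prop :=
  ∃ (lamBar lamTilde : Torus v → Param → ℝ) (lamHat : ZBar → Torus v → Param → ℝ),
    Admissible lamBar ∧ Admissible lamTilde ∧ (∀ n, Admissible (lamHat n)) ∧
    (∀ n x, ∀ σ ∈ paramBox,
      F.lam n x σ = ((n : ℤ) : ℝ) ^ 2 + σ n + ((n : ℤ) : ℝ) * lamBar x σ
        + lamTilde x σ + lamHat n x σ) ∧
    supDerivNorm lamBar ≤ ENNReal.ofReal (∑ i ∈ Finset.range (v + 1), eps ε₀ i) ∧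
    supDerivNorm lamTilde ≤ ENNReal.ofReal (∑ i ∈ Finset.range (v + 1), eps ε₀ i) ∧
    (∀ n, supNorm (lamHat n) ≤
      ENNReal.ofReal ((∑ i ∈ Finset.range (v + 1), eps ε₀ i) * |((n : ℤ) : ℝ)|⁻¹)) ∧
    (∀ n l, supNorm (parDeriv l (lamHat n)) ≤
      ENNReal.ofReal (∑ i ∈ Finset.range (v + 1), eps ε₀ i *
        (|((n : ℤ) : ℝ) * ((l : ℤ) : ℝ)|⁻¹
          + Real.exp (-2 * |((n : ℤ) : ℝ) - ((l : ℤ) : ℝ)| * rho ρ₀ i)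
          + Real.exp (-2 * |((n : ℤ) : ℝ) + ((l : ℤ) : ℝ)| * rho ρ₀ i))))

/-- `|k| = ∑ |k_j|`. -/
def tanNorm {v : ℕ} (k : Tan v → ℤ) : ℕ := ∑ j, (k j).natAbs

/-- `⟨k⟩ = max {1, |k|}`. -/
def tanBracket {v : ℕ} (k : Tan v → ℤ) : ℝ := max 1 (tanNorm k : ℝ)

/-- `|l| = ∑ |l_j|`. -/
def norNorm {v : ℕ} (l : Nor v →₀ ℤ) : ℕ := l.sum (fun _ c => c.natAbs)

/-- `⟨l⟩₂ = max {1, |∑ j² l_j|}`. -/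
def norBracket {v : ℕ} (l : Nor v →₀ ℤ) : ℝ := max 1 |l.sum (fun j c => norVal j ^ 2 * (c : ℝ))|

/-- The resonance index `(k, l)` is compatible with momentum and mass conservation:
`∑ j k_j + ∑ j l_j = 0` and `∑ k_j + ∑ l_j = 0`. Only the monomials `e^{ikx} z^a z̄^b` with
`l = a - b` and `(k, l)` of this kind occur in a Hamiltonian that conserves momentum and mass. -/
def Conserving {v : ℕ} (k : Tan v → ℤ) (l : Nor v →₀ ℤ) : Prop :=
  (∑ j : Tan v, ((j : ZBar) : ℤ) * k j) + l.sum (fun j c => ((j : ZBar) : ℤ) * c) = 0 ∧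
  (∑ j, k j) + l.sum (fun _ c => c) = 0

/-- `k ∈ ℤ^{J_i}`, seen inside `ℤ^{J_v}`. -/
def SupportedOn {v : ℕ} (i : ℕ) (k : Tan v → ℤ) : Prop := ∀ j : Tan v, (j : ZBar) ∉ sites i → k j = 0

open Classical in
/-- The truncation `σ_{k,α,τ}`: entries with `|j| ≥ ⟨k⟩^{2τ+2} / α²` are replaced by `0`. -/
def truncate {v : ℕ} (k : Tan v → ℤ) (α : ℝ) (τ : ℕ) (σ : Param) : Param := fun j =>
  if |((j : ℤ) : ℝ)| < tanBracket k ^ (2 * τ + 2) / α ^ 2 then σ j else 0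

/-- The divisor `⟨k, ω(σ)⟩ + ⟨l, Ω̄(σ)⟩`. -/
def Frequencies.divisor {v : ℕ} (F : Frequencies v) (k : Tan v → ℤ) (l : Nor v →₀ ℤ)
    (σ : Param) : ℝ :=
  (∑ j, (k j : ℝ) * F.ω j σ) + l.sum (fun j c => (c : ℝ) * F.avgΩ j σ)

/-- The truncated resonance zone `R̃_{kl}(α, τ)` inside the parameter set `S`. -/
def Frequencies.resZone {v : ℕ} (F : Frequencies v) (S : Set Param) (k : Tan v → ℤ)
    (l : Nor v →₀ ℤ) (α : ℝ) (τ : ℕ) : Set Param :=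
  {σ ∈ S | |F.divisor k l (truncate k α τ σ)| < 2 * α * (norBracket l / tanBracket k ^ τ)}

/-- `τ_i = 10 i + 10`. -/
def tau (i : ℕ) : ℕ := 10 * i + 10

/-- `ι_v = 2^{v²}`. -/
def iota (v : ℕ) : ℕ := 2 ^ (v ^ 2)

/-- `α_v^i = (α_i / 10) (9 + 2^{-v})` with `α_i = (i^i)^{-A}`. -/
def alpha (A : ℝ) (v i : ℕ) : ℝ := 1 / ((i : ℝ) ^ i) ^ A / 10 * (9 + 1 / 2 ^ v)

/-- `β_v = (v^v)^{-B}`. -/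
def beta (B : ℝ) (v : ℕ) : ℝ := 1 / ((v : ℝ) ^ v) ^ B

/-- The low-order resonances: the union over `0 ≤ i ≤ v` and the conserving `k ∈ ℤ^{J_i}`,
`|k| > ι_v`, of `R̃_{k0}(α_v^i, τ_i)`. -/
def Frequencies.lowRes {v : ℕ} (F : Frequencies v) (S : Set Param) (A : ℝ) : Set Param :=
  {σ | ∃ i ≤ v, ∃ k : Tan v → ℤ, SupportedOn i k ∧ iota v < tanNorm k ∧ Conserving k 0 ∧
    σ ∈ F.resZone S k 0 (alpha A v i) (tau i)}

/-- The normal resonances: the union over the conserving `(k, l)` with `0 ≠ k ∈ ℤ^{J_v}` and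
`0 ≤ |l| ≤ 2` of `R̃_{kl}(β_v, τ_v)`. -/
def Frequencies.normalRes {v : ℕ} (F : Frequencies v) (S : Set Param) (B : ℝ) : Set Param :=
  {σ | ∃ (k : Tan v → ℤ) (l : Nor v →₀ ℤ), k ≠ 0 ∧ norNorm l ≤ 2 ∧ Conserving k l ∧
    σ ∈ F.resZone S k l (beta B v) (tau v)}

end

end DNLS

namespace DNLS

/-! Momentum and mass conservation cancel the terms $n\bar\lambda+\tilde\lambda$, so a conserving
divisor is a constant integer plus $\sum k_j\sigma_j+\sum l_j\sigma_j$ plus the contribution of the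
averages of $\hat\lambda_n$ (`divisor_eq`). Let $m$ maximise $|j||k_j|$. Then
$|k_j|\le|k_m||m|/|j|$, and with this weight the derivative bounds on $\hat\lambda_j$ in $\sigma_m$
have a sum bounded independently of $v$ and $m$ (`exists_weighted_kernel_bound`). For small
$\epsilon_0$ the divisor therefore expands in $\sigma_m$ with factor at least $1/2$
(`exists_expanding_site`). The truncation keeps $\sigma_m$, and Tonelli in that coordinate gives a
zone of measure at most $8i\alpha\langle l\rangle_2/\langle k\rangle^{\tau}$ when $k$ is supported
on $J_i$ (`prodMeasure_resZone_le`).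

The zones are summed over the layers $|k|=n$. There are $O(9^i n^{2i+1})$ choices of $k$. For
$l\ne0$, a resonance forces $\langle l\rangle_2\le14v^2n$ (`norBracket_le_of_resonant`). Together
with momentum this confines the support of $l$ to sites of modulus at most $14v^2n$
(`abs_le_of_mem_support`), so $O(v^4n^2)$ indices $l$ remain. The exponent $\tau_i=10i+10$ beats
these counts and leaves $n^{-2}$, with one more power of $n>\iota_v$ to spare in the first estimate.
Factors of size $i^7 9^i$ go into $(i^i)^{40}$ for $i\ge2$ (`absorb_le_pow_self`). On $J_0$ and
$J_1$ there is no nonzero conserving $k$ with $l=0$, and for $v\le1$ the second bound is at least 1.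
-/

/-! ### Perturbation sizes and decay rates. -/

lemma eps_pos {ε₀ : ℝ} (h : 0 < ε₀) (i : ℕ) : 0 < eps ε₀ i := by
  induction i with
  | zero => exact h
  | succ i ih => exact Real.rpow_pos_of_pos ih _

/-- Each step multiplies by $\epsilon_i^{1/4}$, which is at most $1/2$ as soon as $\epsilon_i\le
2^{-4}$. -/
lemma eps_le_geometric {ε₀ : ℝ} (h : 0 < ε₀) (h' : ε₀ ≤ 1 / 16) (i : ℕ) :
    eps ε₀ i ≤ ε₀ * (1 / 2) ^ i := by
  induction i with
  | zero => simp [eps]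
  | succ i ih =>
    have hp := eps_pos h i
    have hle : eps ε₀ i ≤ (1 / 2) ^ (4 : ℝ) := by
      have : ((1 : ℝ) / 2) ^ i ≤ 1 := pow_le_one₀ (by norm_num) (by norm_num)
      have h16 : ((1 : ℝ) / 2) ^ (4 : ℝ) = 1 / 16 := by
        rw [show (4 : ℝ) = ((4 : ℕ) : ℝ) by norm_num, Real.rpow_natCast]; norm_num
      rw [h16]
      nlinarith
    have hq : eps ε₀ i ^ (1 / 4 : ℝ) ≤ 1 / 2 := by
      calc eps ε₀ i ^ (1 / 4 : ℝ) ≤ ((1 / 2) ^ (4 : ℝ)) ^ (1 / 4 : ℝ) :=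
            Real.rpow_le_rpow hp.le hle (by norm_num)
        _ = 1 / 2 := by rw [← Real.rpow_mul (by norm_num)]; norm_num
    have hsplit : eps ε₀ (i + 1) = eps ε₀ i * eps ε₀ i ^ (1 / 4 : ℝ) := by
      rw [eps, show (5 / 4 : ℝ) = 1 + 1 / 4 by norm_num, Real.rpow_add hp, Real.rpow_one]
    rw [hsplit, pow_succ, ← mul_assoc]
    exact mul_le_mul ih hq (Real.rpow_nonneg hp.le _) (by positivity)

lemma sum_eps_le {ε₀ : ℝ} (h : 0 < ε₀) (h' : ε₀ ≤ 1 / 16) (n : ℕ) :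
    ∑ i ∈ Finset.range n, eps ε₀ i ≤ 2 * ε₀ := by
  calc ∑ i ∈ Finset.range n, eps ε₀ i ≤ ∑ i ∈ Finset.range n, ε₀ * (1 / 2) ^ i :=
        Finset.sum_le_sum fun i _ => eps_le_geometric h h' i
    _ = ε₀ * ∑ i ∈ Finset.range n, (1 / 2 : ℝ) ^ i := by rw [Finset.mul_sum]
    _ ≤ ε₀ * 2 := by
        gcongr
        exact sum_geometric_two_le n
    _ = 2 * ε₀ := mul_comm _ _

lemma sum_inv_sq_le (n : ℕ) :
    ∑ i ∈ Finset.Icc 1 n, 1 / (i : ℝ) ^ 2 ≤ 2 := by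
  -- The extra $-1/(n+1)$ makes the induction telescope.
  have key : ∀ n : ℕ, ∑ i ∈ Finset.Icc 1 (n + 1), 1 / (i : ℝ) ^ 2 ≤ 2 - 1 / (n + 1 : ℝ) := by
    intro n
    induction n with
    | zero => norm_num
    | succ n ih =>
      rw [Finset.sum_Icc_succ_top (by omega)]
      have h : (1 : ℝ) / ((n + 1 + 1 : ℕ) : ℝ) ^ 2 ≤ 1 / (n + 1 : ℝ) - 1 / (n + 1 + 1 : ℝ) := by
        rw [div_sub_div _ _ (by positivity) (by positivity), div_le_div_iff₀ (by positivity)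
          (by positivity)]
        push_cast
        nlinarith [(Nat.cast_nonneg n : (0 : ℝ) ≤ n)]
      push_cast at h ⊢
      linarith
  cases n with
  | zero => simp
  | succ n => exact (key n).trans (by have : (0 : ℝ) ≤ 1 / (n + 1 : ℝ) := by positivity
                                      linarith)

/-- The point is $2\rho_i\ge\rho_0$: all the profiles $e^{-2|\cdot|\rho_i}$ are dominated by the
single profile `kernel ρ₀`. -/
lemma half_le_rho {ρ₀ : ℝ} (h : 0 < ρ₀) (i : ℕ) : ρ₀ / 2 ≤ rho ρ₀ i := by
  have hs : ∑ i ∈ Finset.Icc 1 i, 1 / (10 * (i : ℝ) ^ 2)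
      = 1 / 10 * ∑ i ∈ Finset.Icc 1 i, 1 / (i : ℝ) ^ 2 := by
    rw [Finset.mul_sum]
    exact Finset.sum_congr rfl fun i _ => by rw [one_div_mul_one_div]
  rw [rho, hs]
  nlinarith [sum_inv_sq_le i]

/-! ### The interaction kernel and its weighted sums. -/

/-- The integer underlying an index, as a real number. -/
abbrev ZBar.val (n : ZBar) : ℝ := ((n : ℤ) : ℝ)

lemma ZBar.one_le_abs (n : ZBar) : 1 ≤ |n.val| := by
  have := Int.one_le_abs n.2
  exact_mod_cast this

/-- The profile of the interaction of two sites. -/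
noncomputable def kernel (ρ : ℝ) (n l : ZBar) : ℝ :=
  |n.val * l.val|⁻¹ + Real.exp (-(ρ * |n.val - l.val|)) + Real.exp (-(ρ * |n.val + l.val|))

lemma kernel_le_three {ρ : ℝ} (h : 0 < ρ) (n l : ZBar) : kernel ρ n l ≤ 3 := by
  have h1 : |n.val * l.val|⁻¹ ≤ 1 := by
    rw [abs_mul]
    exact inv_le_one_of_one_le₀ (one_le_mul_of_one_le_of_one_le n.one_le_abs l.one_le_abs)
  have h2 : ∀ x : ℝ, Real.exp (-(ρ * |x|)) ≤ 1 := fun x =>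
    Real.exp_le_one_iff.mpr (by have := abs_nonneg x; nlinarith [mul_nonneg h.le this])
  have := h2 (n.val - l.val)
  have := h2 (n.val + l.val)
  unfold kernel; linarith

lemma rho_kernel_le {ρ₀ : ℝ} (h : 0 < ρ₀) (i : ℕ) (n l : ZBar) :
    |n.val * l.val|⁻¹ + Real.exp (-2 * |n.val - l.val| * rho ρ₀ i)
      + Real.exp (-2 * |n.val + l.val| * rho ρ₀ i) ≤ kernel ρ₀ n l := by
  have hr := half_le_rho h i
  unfold kernel
  gcongr
  · nlinarith [abs_nonneg (n.val - l.val)]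
  · nlinarith [abs_nonneg (n.val + l.val)]

lemma summable_one_add_abs_mul_exp {ρ : ℝ} (h : 0 < ρ) :
    Summable fun n : ℤ => (1 + |(n : ℝ)|) * Real.exp (-(ρ * |(n : ℝ)|)) := by
  have h0 := Real.summable_pow_mul_exp_neg_nat_mul 0 h
  have h1 := Real.summable_pow_mul_exp_neg_nat_mul 1 h
  have h2 : Summable fun n : ℕ => (1 + (n : ℝ)) * Real.exp (-(ρ * (n : ℝ))) := by
    refine (h0.add h1).congr fun n => ?_
    rw [neg_mul]; ring
  exact Summable.of_nat_of_neg (by simpa using h2) (by simpa using h2)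

lemma sum_comp_le_tsum {ι κ : Type*} [Fintype ι] {f : κ → ℝ} (hf : Summable f) (h0 : ∀ a, 0 ≤ f a)
    {i : ι → κ} (hi : Function.Injective i) : ∑ a, f (i a) ≤ ∑' b, f b := by
  have := tsum_comp_le_tsum_of_inj hf h0 hi
  rwa [tsum_fintype] at this

/-- The kernel, weighted by the quotient of the sites, has uniformly bounded row sums. -/
lemma exists_weighted_kernel_bound {ρ : ℝ} (h : 0 < ρ) :
    ∃ M : ℝ, 0 ≤ M ∧ ∀ (v : ℕ) (m : ZBar),
      ∑ j : Tan v, |m.val| / |(j : ZBar).val| * kernel ρ j m ≤ M := by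
  -- Under the weight $|m|/|j|$ the term $|jm|^{-1}$ becomes $1/j^2$, and each exponential gains at
  -- most the factor $1+|j\mp m|$. These majorants `p` and `q` are summable over $\mathbb Z$, and
  -- shifts do not change their sums. Without the weight, $\sum_j|jm|^{-1}$ would grow like $\log v$
  -- when $|m|=1$.
  set q : ℤ → ℝ := fun n => (1 + |(n : ℝ)|) * Real.exp (-(ρ * |(n : ℝ)|)) with hq
  set p : ℤ → ℝ := fun n => 1 / (n : ℝ) ^ 2 with hp
  have sq : Summable q := summable_one_add_abs_mul_exp h
  have sp : Summable p := Real.summable_one_div_int_pow.mpr (by norm_num)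
  have q0 : ∀ n, 0 ≤ q n := fun n => by positivity
  have p0 : ∀ n, 0 ≤ p n := fun n => by positivity
  refine ⟨∑' n, p n + ∑' n, q n + ∑' n, q n, ?_, fun v m => ?_⟩
  · have hq0 : 0 ≤ ∑' n, q n := tsum_nonneg q0
    have hp0 : 0 ≤ ∑' n, p n := tsum_nonneg p0
    positivity
  have inj : Function.Injective fun j : Tan v => ((j : ZBar) : ℤ) :=
    Subtype.val_injective.comp Subtype.val_injective
  have hbound : ∀ j : Tan v, |m.val| / |(j : ZBar).val| * kernel ρ j m ≤
      p ((j : ZBar) : ℤ) + q (((j : ZBar) : ℤ) - m) + q (((j : ZBar) : ℤ) + m) := by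
    intro j
    have hj := (j : ZBar).one_le_abs
    have hm := m.one_le_abs
    have hj0 : |(j : ZBar).val| ≠ 0 := by positivity
    have hm0 : |m.val| ≠ 0 := by positivity
    have key : ∀ x : ℝ, |m.val| ≤ |(j : ZBar).val| + |x| →
        |m.val| / |(j : ZBar).val| ≤ 1 + |x| := by
      intro x hx
      rw [div_le_iff₀ (by positivity)]
      nlinarith [abs_nonneg x]
    have e1 : |m.val| / |(j : ZBar).val| * |(j : ZBar).val * m.val|⁻¹ = p ((j : ZBar) : ℤ) := by
      simp only [hp]
      rw [abs_mul, ← sq_abs]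
      field_simp
    have e2 : |m.val| / |(j : ZBar).val| * Real.exp (-(ρ * |(j : ZBar).val - m.val|))
        ≤ q (((j : ZBar) : ℤ) - m) := by
      simp only [hq]
      push_cast
      gcongr
      apply key
      have := abs_sub_abs_le_abs_sub m.val (j : ZBar).val
      rw [abs_sub_comm] at this
      linarith
    have e3 : |m.val| / |(j : ZBar).val| * Real.exp (-(ρ * |(j : ZBar).val + m.val|))
        ≤ q (((j : ZBar) : ℤ) + m) := by
      simp only [hq]
      push_cast
      gcongr
      apply key
      have := abs_sub_abs_le_abs_sub m.val (-(j : ZBar).val)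
      rw [abs_neg, sub_neg_eq_add, add_comm m.val] at this
      linarith
    rw [kernel, mul_add, mul_add]
    linarith
  calc _ ≤ ∑ j : Tan v, (p ((j : ZBar) : ℤ) + q (((j : ZBar) : ℤ) - m)
        + q (((j : ZBar) : ℤ) + m)) := Finset.sum_le_sum fun j _ => hbound j
    _ ≤ _ := by
      rw [Finset.sum_add_distrib, Finset.sum_add_distrib]
      have i1 := sum_comp_le_tsum sp p0 inj
      have i2 := sum_comp_le_tsum sq q0 ((sub_left_injective (b := (m : ℤ))).comp inj)
      have i3 := sum_comp_le_tsum sq q0 ((add_left_injective (m : ℤ)).comp inj)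
      simp only [Function.comp_apply] at i2 i3
      linarith

/-! ### The parameter box and the average over the angles. -/

lemma zero_mem_cell (j : ZBar) : (0 : ℝ) ∈ cell j := ⟨le_rfl, by positivity⟩

lemma update_mem_paramBox {σ : Param} (hσ : σ ∈ paramBox) {l : ZBar} {s : ℝ} (hs : s ∈ cell l) :
    Function.update σ l s ∈ paramBox := by
  intro j
  rcases eq_or_ne j l with rfl | h
  · simpa using hs
  · simpa [h] using hσ j

lemma abs_le_one_of_mem_paramBox {σ : Param} (hσ : σ ∈ paramBox) (j : ZBar) : |σ j| ≤ 1 := by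
  obtain ⟨h0, h1⟩ := hσ j
  rw [abs_of_nonneg h0]
  exact h1.trans (by rw [one_div]; exact inv_le_one_of_one_le₀ j.one_le_abs)

lemma abs_le_of_supNorm_le {v : ℕ} {f : Torus v → Param → ℝ} {c : ℝ} (hc : 0 ≤ c)
    (h : supNorm f ≤ ENNReal.ofReal c) (x : Torus v) {σ : Param} (hσ : σ ∈ paramBox) :
    |f x σ| ≤ c := by
  rw [← ENNReal.ofReal_le_ofReal_iff hc]
  have hx : ENNReal.ofReal |f x σ| ≤ ⨆ τ ∈ paramBox, ENNReal.ofReal |f x τ| :=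
    le_iSup₂ (f := fun τ (_ : τ ∈ paramBox) => ENNReal.ofReal |f x τ|) σ hσ
  exact hx.trans ((le_iSup (fun x => ⨆ τ ∈ paramBox, ENNReal.ofReal |f x τ|) x).trans h)

lemma lipschitz_of_parDeriv {v : ℕ} {f : Torus v → Param → ℝ} (hf : ParDifferentiable f)
    {l : ZBar} {c : ℝ} (hc : ∀ x, ∀ σ ∈ paramBox, |parDeriv l f x σ| ≤ c) (x : Torus v)
    {σ : Param} (hσ : σ ∈ paramBox) {s s' : ℝ} (hs : s ∈ cell l) (hs' : s' ∈ cell l) :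
    |f x (Function.update σ l s) - f x (Function.update σ l s')| ≤ c * |s - s'| := by
  refine (convex_Icc _ _).norm_image_sub_le_of_norm_derivWithin_le (𝕜 := ℝ) (s := cell l)
    (f := fun s => f x (Function.update σ l s)) ?_ ?_ hs' hs
  · intro r hr
    simpa using hf l x _ (update_mem_paramBox hσ hr)
  · intro r hr
    simpa [parDeriv] using hc x _ (update_mem_paramBox hσ hr)

/-- The frequencies, averaged over the angles, have the expansion
`n² + σ_n + n b + t + H_n`, where `H` is small and separately Lipschitz. -/
structure Frequencies.AveragedAsymptotics {v : ℕ} (F : Frequencies v) (E ρ : ℝ) (b t : Param → ℝ)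
    (H : ZBar → Param → ℝ) : Prop where
  tangential : ∀ σ ∈ paramBox, ∀ n : Tan v,
    F.ω n σ = (n : ZBar).val ^ 2 + σ n + (n : ZBar).val * b σ + t σ + H n σ
  normal : ∀ σ ∈ paramBox, ∀ n : Nor v,
    F.avgΩ n σ = (n : ZBar).val ^ 2 + σ n + (n : ZBar).val * b σ + t σ + H n σ
  bound : ∀ σ ∈ paramBox, ∀ n, |H n σ| ≤ E
  lipschitz : ∀ σ ∈ paramBox, ∀ n l, ∀ s ∈ cell l, ∀ s' ∈ cell l,
    |H n (Function.update σ l s) - H n (Function.update σ l s')| ≤ E * kernel ρ n l * |s - s'|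

lemma integrable_of_continuous_torus {v : ℕ} {f : Torus v → ℝ} (hf : Continuous f) :
    Integrable f :=
  hf.integrable_of_hasCompactSupport (HasCompactSupport.of_compactSpace f)

lemma average_add_torus {v : ℕ} {f g : Torus v → ℝ} (hf : Continuous f) (hg : Continuous g) :
    ⨍ x, (f x + g x) = (⨍ x, f x) + ⨍ x, g x := by
  simp only [average_eq]
  rw [integral_add (integrable_of_continuous_torus hf) (integrable_of_continuous_torus hg),
    smul_add]

lemma average_sub_torus {v : ℕ} {f g : Torus v → ℝ} (hf : Continuous f) (hg : Continuous g) :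
    ⨍ x, (f x - g x) = (⨍ x, f x) - ⨍ x, g x := by
  simp only [average_eq]
  rw [integral_sub (integrable_of_continuous_torus hf) (integrable_of_continuous_torus hg),
    smul_sub]

lemma average_const_torus {v : ℕ} (c : ℝ) : ⨍ _x : Torus v, c = c :=
  average_const _ c

lemma average_mul_torus {v : ℕ} (c : ℝ) (f : Torus v → ℝ) :
    ⨍ x, c * f x = c * ⨍ x, f x := by
  simp only [average_eq, integral_const_mul, smul_eq_mul]
  ring

lemma abs_average_le_torus {v : ℕ} {f : Torus v → ℝ} {c : ℝ} (h : ∀ x, |f x| ≤ c) :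
    |⨍ x, f x| ≤ c := by
  have hm := norm_integral_le_of_norm_le_const (μ := (volume : Measure (Torus v)))
    (f := f) (C := c) (Filter.Eventually.of_forall fun x => h x)
  rw [average_eq, smul_eq_mul, abs_mul, abs_inv, abs_of_nonneg measureReal_nonneg]
  have hpos : 0 < (volume : Measure (Torus v)).real Set.univ :=
    measureReal_univ_pos
  rw [inv_mul_le_iff₀ hpos]
  exact hm.trans_eq (mul_comm _ _)

lemma Frequencies.HasAsymptotics.averaged {v : ℕ} {F : Frequencies v} {ε₀ ρ₀ : ℝ}
    (h : F.HasAsymptotics ε₀ ρ₀) (hε : 0 < ε₀) (hρ : 0 < ρ₀) :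
    ∃ b t H, F.AveragedAsymptotics (∑ i ∈ Finset.range (v + 1), eps ε₀ i) ρ₀ b t H := by
  obtain ⟨lb, lt, lh, ⟨clb, -⟩, ⟨clt, -⟩, hlh, hF, -, -, hb, hd⟩ := h
  set E := ∑ i ∈ Finset.range (v + 1), eps ε₀ i with hE
  have hE0 : 0 ≤ E := Finset.sum_nonneg fun i _ => (eps_pos hε i).le
  have havg : ∀ n : ZBar, ∀ σ ∈ paramBox, ⨍ x, F.lam n x σ =
      n.val ^ 2 + σ n + n.val * (⨍ x, lb x σ) + (⨍ x, lt x σ) + ⨍ x, lh n x σ := by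
    intro n σ hσ
    have c1 := clb σ hσ
    have c2 := clt σ hσ
    have c3 := (hlh n).1 σ hσ
    rw [funext fun x => hF n x σ hσ, average_add_torus (by fun_prop) c3,
      average_add_torus (by fun_prop) c2, average_add_torus (by fun_prop) (by fun_prop),
      average_const_torus, average_mul_torus]
  refine ⟨fun σ => ⨍ x, lb x σ, fun σ => ⨍ x, lt x σ, fun n σ => ⨍ x, lh n x σ,
    ⟨?_, ?_, ?_, ?_⟩⟩
  · intro σ hσ n
    rw [← havg n σ hσ]
    simp only [Frequencies.lam, n.2, dite_true]
    -- A tangential frequency does not depend on the angles, so it equals its average and shares the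
    -- averaged $\bar\lambda$ and $\tilde\lambda$ with the normal ones.
    exact (average_const_torus _).symm
  · intro σ hσ n
    rw [← havg n σ hσ]
    simp only [Frequencies.lam, n.2, dite_false]
    rfl
  · intro σ hσ n
    refine abs_average_le_torus fun x => ?_
    refine (abs_le_of_supNorm_le (by positivity) (hb n) x hσ).trans ?_
    exact mul_le_of_le_one_right hE0 (inv_le_one_of_one_le₀ n.one_le_abs)
  · intro σ hσ n l s hs s' hs'
    have c1 := (hlh n).1 _ (update_mem_paramBox hσ hs)
    have c2 := (hlh n).1 _ (update_mem_paramBox hσ hs')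
    rw [← average_sub_torus c1 c2]
    refine abs_average_le_torus fun x => ?_
    refine lipschitz_of_parDeriv (hlh n).2 (fun y τ hτ => ?_) x hσ hs hs'
    refine (abs_le_of_supNorm_le ?_ (hd n l) y hτ).trans ?_
    · exact Finset.sum_nonneg fun i _ => mul_nonneg (eps_pos hε i).le (by positivity)
    · rw [hE, Finset.sum_mul]
      exact Finset.sum_le_sum fun i _ =>
        mul_le_mul_of_nonneg_left (rho_kernel_le hρ i n l) (eps_pos hε i).le

/-! ### Tonelli in one coordinate of the infinite product. -/

lemma measurable_update_prod (m : ZBar) :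
    Measurable fun p : Param × ℝ => Function.update p.1 m p.2 := by
  rw [measurable_pi_iff]
  intro j
  rcases eq_or_ne j m with rfl | h
  · simpa using measurable_snd
  · simp only [ne_eq, h, not_false_eq_true, Function.update_of_ne]
    exact (measurable_pi_apply j).comp measurable_fst

/-- Resampling one coordinate does not change the product measure. -/
lemma map_update_prodMeasure (m : ZBar) :
    (prodMeasure.prod (cellMeasure m)).map
      (fun p : Param × ℝ => Function.update p.1 m p.2) = prodMeasure := by
  refine Measure.eq_infinitePi cellMeasure fun s t ht => ?_
  rw [Measure.map_apply (measurable_update_prod m) (MeasurableSet.pi s.countable_toSet fun i _ => ht i)]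
  -- The condition on coordinate `m` moves from the sequence to the resampled value.
  set t' : ZBar → Set ℝ := fun j => if j = m then Set.univ else t j with ht'
  have hpre : (fun p : Param × ℝ => Function.update p.1 m p.2) ⁻¹' (Set.pi s t)
      = Set.pi s t' ×ˢ (if m ∈ s then t m else Set.univ) := by
    ext ⟨σ, r⟩
    simp only [Set.mem_preimage, Set.mem_pi, Finset.mem_coe, Set.mem_prod, ht']
    constructor
    · intro h
      refine ⟨fun j hj => ?_, ?_⟩
      · split_ifs with e
        · trivial
        · simpa [e] using h j hj
      · split_ifs with e
        · simpa using h m e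
        · trivial
    · rintro ⟨h1, h2⟩ j hj
      rcases eq_or_ne j m with rfl | e
      · simpa [hj] using h2
      · simpa [e] using h1 j hj
  have hmt : ∀ i, MeasurableSet (t' i) := fun i => by
    simp only [ht']
    split_ifs
    exacts [MeasurableSet.univ, ht i]
  rw [hpre, Measure.prod_prod, prodMeasure, Measure.infinitePi_pi _ fun i _ => hmt i]
  by_cases hm : m ∈ s
  · rw [if_pos hm, ← Finset.mul_prod_erase s _ hm, ← Finset.mul_prod_erase s _ hm]
    have : ∏ i ∈ s.erase m, (cellMeasure i) (t' i) = ∏ i ∈ s.erase m, (cellMeasure i) (t i) :=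
      Finset.prod_congr rfl fun i hi => by simp [ht', Finset.ne_of_mem_erase hi]
    rw [this]
    simp [ht', mul_comm]
  · rw [if_neg hm, measure_univ, mul_one]
    refine Finset.prod_congr rfl fun i hi => ?_
    have : i ≠ m := fun e => hm (e ▸ hi)
    simp [ht', this]

/-- Lebesgue measure on the line is at most the diameter; the factor $|m|$ is the normalisation. -/
lemma cellMeasure_le_of_dist_le (m : ZBar) {A : Set ℝ} (hA : MeasurableSet A) {d : ℝ}
    (h : ∀ s ∈ A ∩ cell m, ∀ s' ∈ A ∩ cell m, |s - s'| ≤ d) :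
    cellMeasure m A ≤ ENNReal.ofReal (|m.val| * d) := by
  rw [cellMeasure, Measure.smul_apply, smul_eq_mul, Measure.restrict_apply hA,
    ENNReal.ofReal_mul (abs_nonneg _)]
  gcongr
  refine (Real.volume_le_diam _).trans (Metric.ediam_le fun s hs s' hs' => ?_)
  rw [edist_dist, Real.dist_eq]
  exact ENNReal.ofReal_le_ofReal (h s hs s' hs')

/-- A function that expands in one parameter is rarely small. -/
lemma prodMeasure_sublevel_le (m : ZBar) {h : Param → ℝ} (hmeas : Measurable h) {c δ : ℝ}
    (hc : 0 < c)
    (hexp : ∀ σ, ∀ s ∈ cell m, ∀ s' ∈ cell m,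
      c * |s - s'| ≤ |h (Function.update σ m s) - h (Function.update σ m s')|) :
    prodMeasure {σ | |h σ| < δ} ≤ ENNReal.ofReal (|m.val| * (2 * δ / c)) := by
  have hms : MeasurableSet {σ | |h σ| < δ} := measurableSet_lt hmeas.abs measurable_const
  -- On a fibre in coordinate `m`, two points of the sublevel set have values less than $2\delta$
  -- apart, so expansion puts them within $2\delta/c$ of each other.
  rw [← map_update_prodMeasure m, Measure.map_apply (measurable_update_prod m) hms,
    Measure.prod_apply (measurable_update_prod m hms)]
  have hP : IsProbabilityMeasure prodMeasure := by unfold prodMeasure; infer_instance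
  calc _ ≤ ∫⁻ _, ENNReal.ofReal (|m.val| * (2 * δ / c)) ∂prodMeasure := by
        refine lintegral_mono fun σ => cellMeasure_le_of_dist_le m ?_ ?_
        · exact measurable_prodMk_left (measurable_update_prod m hms)
        · rintro s ⟨hs, hsc⟩ s' ⟨hs', hsc'⟩
          simp only [Set.mem_preimage, Set.mem_ofPred_eq] at hs hs'
          rw [le_div_iff₀ hc]
          have := hexp σ s hsc s' hsc'
          have := abs_sub (h (Function.update σ m s)) (h (Function.update σ m s'))
          linarith
    _ = _ := by simp

/-! ### Truncated parameters and continuity. -/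

/-- Clamping into the box, followed by truncation at the height `K`. -/
noncomputable def clampTruncate (K : ℝ) (σ : Param) : Param := fun j =>
  open Classical in if |j.val| < K then max 0 (min (σ j) (1 / |j.val|)) else 0

lemma clamp_mem_cell (j : ZBar) (s : ℝ) : max 0 (min s (1 / |j.val|)) ∈ cell j :=
  ⟨le_max_left _ _, max_le (by positivity) (min_le_right _ _)⟩

lemma clamp_eq_self {j : ZBar} {s : ℝ} (h : s ∈ cell j) : max 0 (min s (1 / |j.val|)) = s := by
  rw [min_eq_left h.2, max_eq_right h.1]

/-- This is why parameters are clamped: the asymptotics hold only on the box, while measurability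
and the expansion hypothesis of `prodMeasure_sublevel_le` concern all sequences. -/
lemma clampTruncate_mem_paramBox (K : ℝ) (σ : Param) : clampTruncate K σ ∈ paramBox := by
  intro j
  unfold clampTruncate
  split_ifs
  exacts [clamp_mem_cell j _, zero_mem_cell j]

lemma clampTruncate_update (K : ℝ) (σ : Param) {m : ZBar} (hm : |m.val| < K) {s : ℝ}
    (hs : s ∈ cell m) :
    clampTruncate K (Function.update σ m s) = Function.update (clampTruncate K σ) m s := by
  ext j
  rcases eq_or_ne j m with rfl | h
  · simp only [clampTruncate, hm, if_true, Function.update_self, clamp_eq_self hs]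
  · simp [clampTruncate, h]

lemma truncate_eq_clampTruncate {v : ℕ} (k : Tan v → ℤ) (α : ℝ) (τ : ℕ) {σ : Param}
    (hσ : σ ∈ paramBox) :
    truncate k α τ σ = clampTruncate (tanBracket k ^ (2 * τ + 2) / α ^ 2) σ := by
  ext j
  simp only [truncate, clampTruncate, clamp_eq_self (hσ j)]

lemma mem_sites {v : ℕ} {j : ZBar} : j ∈ sites v ↔ |j.val| ≤ v := by
  rw [sites, Finset.mem_subtype, Finset.mem_Icc, ← abs_le]
  exact_mod_cast Iff.rfl

/-- A separately Lipschitz function is jointly Lipschitz in finitely many parameters. -/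
lemma abs_sub_le_sum_of_separately_lipschitz {G : Param → ℝ} {L : ℝ}
    (hG : ∀ σ ∈ paramBox, ∀ l, ∀ s ∈ cell l, ∀ s' ∈ cell l,
      |G (Function.update σ l s) - G (Function.update σ l s')| ≤ L * |s - s'|)
    (T : Finset ZBar) {σ σ' : Param} (hσ : σ ∈ paramBox) (hσ' : σ' ∈ paramBox)
    (h : ∀ j ∉ T, σ j = σ' j) : |G σ - G σ'| ≤ ∑ j ∈ T, L * |σ j - σ' j| := by
  induction T using Finset.induction_on generalizing σ with
  | empty =>
    have : σ = σ' := funext fun j => h j (by simp)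
    simp [this]
  | insert a T ha ih =>
    have h1 := ih (σ := Function.update σ a (σ' a)) (update_mem_paramBox hσ (hσ' a)) (by
      intro j hj
      rcases eq_or_ne j a with rfl | e
      · simp
      · rw [Function.update_of_ne e]
        exact h j (by simp [e, hj]))
    have h2 := hG σ hσ a (σ a) (hσ a) (σ' a) (hσ' a)
    rw [Function.update_eq_self] at h2
    rw [Finset.sum_insert ha]
    have h3 : ∑ j ∈ T, L * |Function.update σ a (σ' a) j - σ' j| = ∑ j ∈ T, L * |σ j - σ' j| :=
      Finset.sum_congr rfl fun j hj => by
        rw [Function.update_of_ne (ne_of_mem_of_not_mem hj ha)]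
    rw [h3] at h1
    exact (abs_sub_le _ (G (Function.update σ a (σ' a))) _).trans (add_le_add h2 h1)

/-- After truncation only the finitely many coordinates with $|j|<K$ vary, so the separate Lipschitz
bounds add up to continuity in the product topology. This supplies the measurability of truncated
divisors. -/
lemma continuous_comp_clampTruncate {G : Param → ℝ} {L : ℝ}
    (hG : ∀ σ ∈ paramBox, ∀ l, ∀ s ∈ cell l, ∀ s' ∈ cell l,
      |G (Function.update σ l s) - G (Function.update σ l s')| ≤ L * |s - s'|) (K : ℝ) :
    Continuous fun σ => G (clampTruncate K σ) := by
  rw [continuous_iff_continuousAt]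
  intro σ₀
  have hcont : ∀ j, Continuous fun σ => clampTruncate K σ j := by
    intro j
    unfold clampTruncate
    split_ifs <;> fun_prop
  have hlim : Filter.Tendsto (fun σ => ∑ j ∈ sites ⌈K⌉₊,
      L * |clampTruncate K σ j - clampTruncate K σ₀ j|) (nhds σ₀) (nhds 0) := by
    have hc : Continuous fun σ => ∑ j ∈ sites ⌈K⌉₊,
        L * |clampTruncate K σ j - clampTruncate K σ₀ j| :=
      continuous_finsetSum _ fun j _ =>
        continuous_const.mul ((hcont j).sub continuous_const).abs
    simpa using hc.tendsto σ₀
  rw [ContinuousAt, tendsto_iff_dist_tendsto_zero]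
  refine squeeze_zero (fun _ => dist_nonneg) (fun σ => ?_) hlim
  rw [Real.dist_eq]
  refine abs_sub_le_sum_of_separately_lipschitz hG _ (clampTruncate_mem_paramBox K σ)
    (clampTruncate_mem_paramBox K σ₀) fun j hj => ?_
  have : ¬ |j.val| < K := fun hlt => hj (mem_sites.mpr (hlt.le.trans (Nat.le_ceil K)))
  simp [clampTruncate, this]

/-! ### Divisors of conserving indices: expansion and single zones. -/

lemma sum_abs_tan {v : ℕ} (k : Tan v → ℤ) : ∑ j, |(k j : ℝ)| = tanNorm k := by
  rw [tanNorm, Nat.cast_sum]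
  exact Finset.sum_congr rfl fun j _ => by rw [Nat.cast_natAbs, Int.cast_abs]

lemma sum_abs_nor {v : ℕ} (l : Nor v →₀ ℤ) : ∑ j ∈ l.support, |(l j : ℝ)| = norNorm l := by
  rw [norNorm, Finsupp.sum, Nat.cast_sum]
  exact Finset.sum_congr rfl fun j _ => by rw [Nat.cast_natAbs, Int.cast_abs]

/-- The pairing of a resonance index with a sequence. -/
noncomputable def pairing {v : ℕ} (k : Tan v → ℤ) (l : Nor v →₀ ℤ) (f : ZBar → ℝ) : ℝ :=
  ∑ j, (k j : ℝ) * f j + ∑ j ∈ l.support, (l j : ℝ) * f j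

lemma pairing_add {v : ℕ} (k : Tan v → ℤ) (l : Nor v →₀ ℤ) (f g : ZBar → ℝ) :
    pairing k l (fun n => f n + g n) = pairing k l f + pairing k l g := by
  simp only [pairing, mul_add, Finset.sum_add_distrib]
  ring

lemma pairing_sub {v : ℕ} (k : Tan v → ℤ) (l : Nor v →₀ ℤ) (f g : ZBar → ℝ) :
    pairing k l (fun n => f n - g n) = pairing k l f - pairing k l g := by
  simp only [pairing, mul_sub, Finset.sum_sub_distrib]
  ring

lemma pairing_mul_const {v : ℕ} (k : Tan v → ℤ) (l : Nor v →₀ ℤ) (f : ZBar → ℝ) (c : ℝ) :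
    pairing k l (fun n => f n * c) = pairing k l f * c := by
  simp only [pairing, ← mul_assoc, add_mul, Finset.sum_mul]

lemma abs_pairing_le {v : ℕ} (k : Tan v → ℤ) (l : Nor v →₀ ℤ) {f : ZBar → ℝ} {c : ℝ}
    (h : ∀ n, |f n| ≤ c) : |pairing k l f| ≤ (tanNorm k + norNorm l) * c := by
  rw [← sum_abs_tan, ← sum_abs_nor, add_mul, Finset.sum_mul, Finset.sum_mul]
  refine (abs_add_le _ _).trans (add_le_add ?_ ?_) <;>
  · refine (Finset.abs_sum_le_sum_abs _ _).trans (Finset.sum_le_sum fun j _ => ?_)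
    rw [abs_mul]
    exact mul_le_mul_of_nonneg_left (h j) (abs_nonneg _)

lemma Conserving.pairing_val {v : ℕ} {k : Tan v → ℤ} {l : Nor v →₀ ℤ} (h : Conserving k l) :
    pairing k l ZBar.val = 0 := by
  have := h.1
  rw [Finsupp.sum] at this
  simp only [pairing, mul_comm]
  exact_mod_cast this

lemma Conserving.pairing_one {v : ℕ} {k : Tan v → ℤ} {l : Nor v →₀ ℤ} (h : Conserving k l) :
    pairing k l (fun _ => 1) = 0 := by
  have := h.2
  rw [Finsupp.sum] at this
  simp only [pairing, mul_one]
  exact_mod_cast this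

namespace Frequencies.AveragedAsymptotics

variable {v : ℕ} {F : Frequencies v} {E ρ : ℝ} {b t : Param → ℝ} {H : ZBar → Param → ℝ}

/-- The conservation laws remove the `n`-independent parts of the frequencies from the divisor. -/
lemma divisor_eq (hF : F.AveragedAsymptotics E ρ b t H) {k : Tan v → ℤ} {l : Nor v →₀ ℤ}
    (h : Conserving k l) {σ : Param} (hσ : σ ∈ paramBox) :
    F.divisor k l σ = pairing k l (fun n => n.val ^ 2) + pairing k l σ
      + pairing k l (fun n => H n σ) := by
  have h1 : F.divisor k l σ =
      pairing k l (fun n => n.val ^ 2 + σ n + n.val * b σ + 1 * t σ + H n σ) := by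
    simp only [divisor, pairing, Finsupp.sum, one_mul]
    congr 1
    · exact Finset.sum_congr rfl fun j _ => by rw [hF.tangential σ hσ]
    · exact Finset.sum_congr rfl fun j _ => by rw [hF.normal σ hσ]
  rw [h1, pairing_add, pairing_add, pairing_add, pairing_add, pairing_mul_const,
    pairing_mul_const, h.pairing_val, h.pairing_one]
  ring

lemma divisor_sub_eq (hF : F.AveragedAsymptotics E ρ b t H) {k : Tan v → ℤ} {l : Nor v →₀ ℤ}
    (h : Conserving k l) {σ σ' : Param} (hσ : σ ∈ paramBox) (hσ' : σ' ∈ paramBox) :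
    F.divisor k l σ - F.divisor k l σ' =
      pairing k l (fun n => σ n - σ' n) + pairing k l (fun n => H n σ - H n σ') := by
  rw [hF.divisor_eq h hσ, hF.divisor_eq h hσ', pairing_sub, pairing_sub]
  ring

lemma separately_lipschitz (hF : F.AveragedAsymptotics E ρ b t H) (hE : 0 ≤ E) (hρ : 0 < ρ)
    (n l : ZBar) {σ : Param} (hσ : σ ∈ paramBox) {s s' : ℝ} (hs : s ∈ cell l)
    (hs' : s' ∈ cell l) :
    |H n (Function.update σ l s) - H n (Function.update σ l s')| ≤ 3 * E * |s - s'| := by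
  refine (hF.lipschitz σ hσ n l s hs s' hs').trans ?_
  rw [mul_comm 3]
  gcongr
  exact kernel_le_three hρ n l

/-- The size of the constant is irrelevant; its finiteness gives continuity of the truncated
divisor. -/
lemma divisor_separately_lipschitz (hF : F.AveragedAsymptotics E ρ b t H) (hE : 0 ≤ E)
    (hρ : 0 < ρ) {k : Tan v → ℤ} {l : Nor v →₀ ℤ} (h : Conserving k l) {σ : Param}
    (hσ : σ ∈ paramBox) (p : ZBar) {s s' : ℝ} (hs : s ∈ cell p) (hs' : s' ∈ cell p) :
    |F.divisor k l (Function.update σ p s) - F.divisor k l (Function.update σ p s')|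
      ≤ (tanNorm k + norNorm l) * (1 + 3 * E) * |s - s'| := by
  rw [hF.divisor_sub_eq h (update_mem_paramBox hσ hs) (update_mem_paramBox hσ hs')]
  have h1 : |pairing k l (fun n => Function.update σ p s n - Function.update σ p s' n)|
      ≤ (tanNorm k + norNorm l) * |s - s'| := by
    refine abs_pairing_le k l fun n => ?_
    rcases eq_or_ne n p with rfl | e
    · simp
    · simp [e]
  have h2 := abs_pairing_le k l fun n => hF.separately_lipschitz hE hρ n p hσ hs hs'
  refine (abs_add_le _ _).trans ((add_le_add h1 h2).trans_eq ?_)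
  ring

/-- Some tangential parameter in the support of `k` moves the divisor at least at speed `1/2`. -/
lemma exists_expanding_site (hF : F.AveragedAsymptotics E ρ b t H) (hE : 0 ≤ E) (hρ : 0 < ρ)
    {M : ℝ} (hM : ∀ m : ZBar, ∑ j : Tan v, |m.val| / |(j : ZBar).val| * kernel ρ j m ≤ M)
    (hEM : E * (M + 6) ≤ 1 / 2) {k : Tan v → ℤ} (hk : k ≠ 0) {l : Nor v →₀ ℤ}
    (hl : norNorm l ≤ 2) (h : Conserving k l) :
    ∃ m : Tan v, k m ≠ 0 ∧ ∀ σ ∈ paramBox, ∀ s ∈ cell m, ∀ s' ∈ cell m,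
      1 / 2 * |s - s'| ≤
        |F.divisor k l (Function.update σ m s) - F.divisor k l (Function.update σ m s')| := by
  obtain ⟨j₀, hj₀⟩ := Function.ne_iff.mp hk
  -- Maximising $|j||k_j|$ rather than $|k_j|$ yields $|k_j|\le|k_m||m|/|j|$, the weight for which
  -- the kernel sums are bounded by `M`.
  obtain ⟨m, -, hm⟩ := Finset.exists_max_image Finset.univ
    (fun j : Tan v => |(j : ZBar).val| * |(k j : ℝ)|) ⟨j₀, Finset.mem_univ _⟩
  have hkm : k m ≠ 0 := by
    intro h0
    have h1 := hm j₀ (Finset.mem_univ _)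
    have h2 := (j₀ : ZBar).one_le_abs
    have h3 : 0 < |(k j₀ : ℝ)| := abs_pos.mpr (Int.cast_ne_zero.mpr hj₀)
    rw [h0] at h1
    simp only [Int.cast_zero, abs_zero, mul_zero] at h1
    nlinarith
  have hkm1 : (1 : ℝ) ≤ |(k m : ℝ)| := by exact_mod_cast Int.one_le_abs hkm
  refine ⟨m, hkm, fun σ hσ s hs s' hs' => ?_⟩
  rw [hF.divisor_sub_eq h (update_mem_paramBox hσ hs) (update_mem_paramBox hσ hs')]
  set d := |s - s'| with hd
  have hd0 : 0 ≤ d := abs_nonneg _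
  have h1 : pairing k l (fun n => Function.update σ m s n - Function.update σ m s' n)
      = k m * (s - s') := by
    rw [pairing, Finset.sum_eq_single m, Finset.sum_eq_zero]
    · simp
    · intro j _
      have : (j : ZBar) ≠ m := fun e => j.2 (e ▸ m.2)
      simp [this]
    · intro j _ hj
      have : (j : ZBar) ≠ m := fun e => hj (Subtype.ext e)
      simp [this]
    · simp
  -- The tangential indices give `M`; the normal ones give $6=2\cdot3$, from $|l|\le2$ and the crude
  -- bound `kernel_le_three`.
  have h2 : |pairing k l (fun n => H n (Function.update σ m s) - H n (Function.update σ m s'))|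
      ≤ |(k m : ℝ)| * (E * M) * d + 6 * E * d := by
    refine (abs_add_le _ _).trans (add_le_add ?_ ?_)
    · calc _ ≤ ∑ j : Tan v, |(k m : ℝ)| * (E * d) *
            (|(m : ZBar).val| / |(j : ZBar).val| * kernel ρ j m) := by
            refine (Finset.abs_sum_le_sum_abs _ _).trans (Finset.sum_le_sum fun j _ => ?_)
            have hj := (j : ZBar).one_le_abs
            have hkj : |(k j : ℝ)| ≤ |(k m : ℝ)| * (|(m : ZBar).val| / |(j : ZBar).val|) := by
              rw [← mul_div_assoc, le_div_iff₀ (by positivity)]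
              have := hm j (Finset.mem_univ _)
              linarith
            rw [abs_mul]
            calc _ ≤ |(k m : ℝ)| * (|(m : ZBar).val| / |(j : ZBar).val|) *
                  (E * kernel ρ j m * d) :=
                  mul_le_mul hkj (hF.lipschitz σ hσ j m s hs s' hs') (abs_nonneg _)
                    (by positivity)
              _ = _ := by ring
        _ ≤ |(k m : ℝ)| * (E * d) * M := by
            rw [← Finset.mul_sum]
            exact mul_le_mul_of_nonneg_left (hM m) (by positivity)
        _ = _ := by ring
    · have hl' : (norNorm l : ℝ) ≤ 2 := by exact_mod_cast hl
      calc _ ≤ ∑ j ∈ l.support, |(l j : ℝ)| * (3 * E * d) := by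
            refine (Finset.abs_sum_le_sum_abs _ _).trans (Finset.sum_le_sum fun j _ => ?_)
            rw [abs_mul]
            exact mul_le_mul_of_nonneg_left (hF.separately_lipschitz hE hρ j m hσ hs hs')
              (abs_nonneg _)
        _ = norNorm l * (3 * E * d) := by rw [← Finset.sum_mul, sum_abs_nor]
        _ ≤ 2 * (3 * E * d) := by gcongr
        _ = _ := by ring
  have h3 : |(k m : ℝ) * (s - s')| = |(k m : ℝ)| * d := abs_mul _ _
  have h4 := abs_sub_abs_le_abs_add ((k m : ℝ) * (s - s'))
    (pairing k l (fun n => H n (Function.update σ m s) - H n (Function.update σ m s')))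
  rw [h1]
  -- Since $|k_m|\ge1$, the normal contribution is also absorbed into a multiple of $|k_m|d$. At
  -- least $|k_m|d/2\ge d/2$ of the main term survives.
  have h5 : |(k m : ℝ)| * (E * M) * d + 6 * E * d ≤ |(k m : ℝ)| * d * (E * (M + 6)) := by
    nlinarith [mul_nonneg (sub_nonneg.mpr hkm1) (mul_nonneg hE hd0)]
  have h6 : |(k m : ℝ)| * d * (E * (M + 6)) ≤ |(k m : ℝ)| * d * (1 / 2) := by gcongr
  nlinarith [mul_nonneg (sub_nonneg.mpr hkm1) hd0]

/-- The measure of a single resonance zone. -/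
lemma prodMeasure_resZone_le (hF : F.AveragedAsymptotics E ρ b t H) (hE : 0 ≤ E) (hρ : 0 < ρ)
    {M : ℝ} (hM : ∀ m : ZBar, ∑ j : Tan v, |m.val| / |(j : ZBar).val| * kernel ρ j m ≤ M)
    (hEM : E * (M + 6) ≤ 1 / 2) {k : Tan v → ℤ} (hk : k ≠ 0) {l : Nor v →₀ ℤ}
    (hl : norNorm l ≤ 2) (h : Conserving k l) {i : ℕ} (hi : SupportedOn i k)
    {α : ℝ} (hα : 0 < α) {τ : ℕ} (hcut : (i : ℝ) < tanBracket k ^ (2 * τ + 2) / α ^ 2)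
    {S : Set Param} (hS : S ⊆ paramBox) :
    prodMeasure (F.resZone S k l α τ) ≤
      ENNReal.ofReal (i * (8 * α * (norBracket l / tanBracket k ^ τ))) := by
  obtain ⟨m, hkm, hm⟩ := hF.exists_expanding_site hE hρ hM hEM hk hl h
  have hmi : |(m : ZBar).val| ≤ i := by
    by_contra hcon
    exact hkm (hi m fun hmem => hcon (mem_sites.mp hmem))
  set K := tanBracket k ^ (2 * τ + 2) / α ^ 2 with hK
  have hcont := continuous_comp_clampTruncate (G := F.divisor k l)
    (fun σ hσ p s hs s' hs' => hF.divisor_separately_lipschitz hE hρ h hσ p hs hs') K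
  have hbr : 0 ≤ norBracket l / tanBracket k ^ τ :=
    div_nonneg (zero_le_one.trans (le_max_left _ _))
      (pow_nonneg (zero_le_one.trans (le_max_left _ _)) _)
  -- The arbitrary set `S` is dropped here: the zone lies in a sublevel set of a continuous
  -- function, so an outer measure suffices.
  calc prodMeasure (F.resZone S k l α τ)
      ≤ prodMeasure {σ | |F.divisor k l (clampTruncate K σ)| <
          2 * α * (norBracket l / tanBracket k ^ τ)} := by
        refine measure_mono fun σ hσ => ?_
        have := hσ.2
        rwa [truncate_eq_clampTruncate k α τ (hS hσ.1)] at this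
    _ ≤ ENNReal.ofReal (|(m : ZBar).val| *
          (2 * (2 * α * (norBracket l / tanBracket k ^ τ)) / (1 / 2))) := by
        refine prodMeasure_sublevel_le m hcont.measurable (by norm_num) fun σ s hs s' hs' => ?_
        rw [clampTruncate_update K σ (hmi.trans_lt hcut) hs,
          clampTruncate_update K σ (hmi.trans_lt hcut) hs']
        exact hm _ (clampTruncate_mem_paramBox K σ) s hs s' hs'
    _ ≤ _ := by
        apply ENNReal.ofReal_le_ofReal
        calc _ = |(m : ZBar).val| * (8 * α * (norBracket l / tanBracket k ^ τ)) := by ring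
          _ ≤ _ := by gcongr

/-- A resonance bounds the normal part of the divisor by the tangential one. -/
lemma norBracket_le_of_resonant (hF : F.AveragedAsymptotics E ρ b t H) (hE1 : E ≤ 1)
    (hv : 1 ≤ v) {k : Tan v → ℤ} (hk : 2 ≤ tanNorm k) {l : Nor v →₀ ℤ} (hl : norNorm l ≤ 2)
    (h : Conserving k l) {α : ℝ} (hα : 0 < α) (hα1 : α ≤ 1) {τ : ℕ} (hτ : 2 ≤ τ)
    {σ : Param} (hσ : σ ∈ paramBox)
    (hres : |F.divisor k l σ| < 2 * α * (norBracket l / tanBracket k ^ τ)) :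
    norBracket l ≤ 14 * v ^ 2 * tanNorm k := by
  have hk' : (2 : ℝ) ≤ tanNorm k := by exact_mod_cast hk
  have hv' : (1 : ℝ) ≤ (v : ℝ) ^ 2 := by exact_mod_cast Nat.one_le_pow _ _ hv
  have hl' : (norNorm l : ℝ) ≤ 2 := by exact_mod_cast hl
  have hbr : tanBracket k = tanNorm k := max_eq_right (by linarith)
  have hnb : 1 ≤ norBracket l := le_max_left _ _
  have h4 : (4 : ℝ) ≤ tanBracket k ^ τ := by
    rw [hbr]
    calc (4 : ℝ) = 2 ^ 2 := by norm_num
      _ ≤ 2 ^ τ := pow_le_pow_right₀ (by norm_num) hτ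
      _ ≤ _ := pow_le_pow_left₀ (by norm_num) hk' _
  -- With $\langle k\rangle^\tau\ge4$ the resonance threshold is at most half of $\langle
  -- l\rangle_2$ and can be absorbed on the left.
  have hsmall : 2 * α * (norBracket l / tanBracket k ^ τ) ≤ norBracket l / 2 := by
    have h5 : norBracket l / tanBracket k ^ τ ≤ norBracket l / 4 := by gcongr
    have h6 : 0 ≤ norBracket l / tanBracket k ^ τ := by positivity
    nlinarith
  rw [hF.divisor_eq h hσ] at hres
  have b1 := abs_pairing_le k l (abs_le_one_of_mem_paramBox hσ)
  have b2 := abs_pairing_le k l fun n => (hF.bound σ hσ n).trans hE1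
  have b3 : |∑ j, (k j : ℝ) * (j : ZBar).val ^ 2| ≤ tanNorm k * v ^ 2 := by
    rw [← sum_abs_tan, Finset.sum_mul]
    refine (Finset.abs_sum_le_sum_abs _ _).trans (Finset.sum_le_sum fun j _ => ?_)
    rw [abs_mul, abs_of_nonneg (sq_nonneg (j : ZBar).val), ← sq_abs (j : ZBar).val]
    gcongr
    exact mem_sites.mp j.2
  set Q := ∑ j ∈ l.support, (l j : ℝ) * (j : ZBar).val ^ 2 with hQ
  have hnQ : norBracket l = max 1 |Q| := by
    simp only [norBracket, Finsupp.sum, hQ, norVal, mul_comm]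
  have hp : pairing k l (fun n => n.val ^ 2) =
    ∑ j, (k j : ℝ) * (j : ZBar).val ^ 2 + Q := rfl
  rw [hp] at hres
  set T := ∑ j, (k j : ℝ) * (j : ZBar).val ^ 2
  have hQle : |Q| ≤ tanNorm k * v ^ 2 + 2 * (tanNorm k + 2) + norBracket l / 2 := by
    rw [abs_le] at *
    rw [abs_lt] at hres
    constructor <;> linarith
  -- When the maximum is $|Q|$, absorbing its half leaves $|Q|\le 2|k|v^2+4|k|+8\le10|k|v^2$,
  -- because $|k|\ge2$ and $v\ge1$; the constant 14 is not sharp.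
  rcases max_choice 1 |Q| with e | e <;> rw [e] at hnQ <;> nlinarith

end Frequencies.AveragedAsymptotics

/-! ### Short normal indices and the conservation laws. -/

/-- A nonzero normal index splits off a signed unit vector. -/
lemma exists_signed_unit {v : ℕ} {l : Nor v →₀ ℤ} (hl : l ≠ 0) :
    ∃ a ∈ l.support, ∃ c : ℤ, (c = 1 ∨ c = -1) ∧ ∃ l' : Nor v →₀ ℤ,
      l = Finsupp.single a c + l' ∧ l'.support ⊆ l.support ∧ norNorm l' + 1 = norNorm l := by
  obtain ⟨a, ha⟩ := Finsupp.support_nonempty_iff.mpr hl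
  have ha0 : l a ≠ 0 := Finsupp.mem_support_iff.mp ha
  have key : ∀ c : ℤ, (l a - c).natAbs + 1 = (l a).natAbs →
      (l - Finsupp.single a c).support ⊆ l.support ∧
        norNorm (l - Finsupp.single a c) + 1 = norNorm l := by
    intro c hc
    have hsub : (l - Finsupp.single a c).support ⊆ l.support := by
      intro j hj
      rcases eq_or_ne j a with rfl | e
      · exact ha
      · simpa [Finsupp.single_apply, e.symm] using hj
    refine ⟨hsub, ?_⟩
    rw [norNorm, Finsupp.sum_of_support_subset _ hsub _ (by simp), norNorm, Finsupp.sum,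
      ← Finset.add_sum_erase _ _ ha, ← Finset.add_sum_erase _ _ ha]
    have : ∑ j ∈ l.support.erase a, ((l - Finsupp.single a c) j).natAbs
        = ∑ j ∈ l.support.erase a, (l j).natAbs :=
      Finset.sum_congr rfl fun j hj => by
        simp [(Finset.ne_of_mem_erase hj).symm]
    rw [this]
    simp only [Finsupp.coe_sub, Pi.sub_apply, Finsupp.single_eq_same]
    omega
  rcases lt_or_gt_of_ne ha0 with h | h
  · exact ⟨a, ha, -1, Or.inr rfl, l - Finsupp.single a (-1), (add_sub_cancel _ _).symm,
      key _ (by omega)⟩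
  · exact ⟨a, ha, 1, Or.inl rfl, l - Finsupp.single a 1, (add_sub_cancel _ _).symm,
      key _ (by omega)⟩

lemma eq_zero_of_norNorm_eq_zero {v : ℕ} {l : Nor v →₀ ℤ} (h : norNorm l = 0) : l = 0 := by
  by_contra hl
  obtain ⟨_, _, _, _, _, _, _, h'⟩ := exists_signed_unit hl
  omega

/-- The normal indices of length at most two. -/
lemma norNorm_le_two_cases {v : ℕ} {l : Nor v →₀ ℤ} (h : norNorm l ≤ 2) :
    l = 0 ∨ (∃ a ∈ l.support, ∃ c : ℤ, (c = 1 ∨ c = -1) ∧ l = Finsupp.single a c) ∨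
      ∃ a ∈ l.support, ∃ b ∈ l.support, ∃ c d : ℤ, (c = 1 ∨ c = -1) ∧ (d = 1 ∨ d = -1) ∧
        l = Finsupp.single a c + Finsupp.single b d := by
  by_cases hl : l = 0
  · exact Or.inl hl
  obtain ⟨a, ha, c, hc, l', e, hs, hn⟩ := exists_signed_unit hl
  by_cases hl' : l' = 0
  · exact Or.inr (Or.inl ⟨a, ha, c, hc, by rw [e, hl', add_zero]⟩)
  obtain ⟨b, hb, d, hd, l'', e', -, hn'⟩ := exists_signed_unit hl'
  have : l'' = 0 := eq_zero_of_norNorm_eq_zero (by omega)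
  exact Or.inr (Or.inr ⟨a, ha, b, hs hb, c, d, hc, hd, by rw [e, e', this, add_zero]⟩)

lemma sum_single_mul {v : ℕ} (f : Nor v → ℤ) (a : Nor v) (c : ℤ) :
    (Finsupp.single a c).sum (fun j c => f j * c) = f a * c :=
  Finsupp.sum_single_index (mul_zero _)

lemma sum_add_mul {v : ℕ} (f : Nor v → ℤ) (x y : Nor v →₀ ℤ) :
    (x + y).sum (fun j c => f j * c) = x.sum (fun j c => f j * c) + y.sum (fun j c => f j * c) :=
  Finsupp.sum_add_index' (fun _ => mul_zero _) (fun _ _ _ => mul_add _ _ _)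

/-- The factor 1 puts the mass law into the shape handled by `sum_single_mul` and `sum_add_mul`. -/
lemma Conserving.mass {v : ℕ} {k : Tan v → ℤ} {l : Nor v →₀ ℤ} (h : Conserving k l) :
    (∑ j, k j) + l.sum (fun _ c => 1 * c) = 0 := by simpa using h.2

lemma tanNorm_eq_zero {v : ℕ} {k : Tan v → ℤ} : tanNorm k = 0 ↔ k = 0 := by
  simp [tanNorm, funext_iff]

/-- The conservation laws exclude tangential indices of length one. -/
lemma Conserving.two_le_tanNorm {v : ℕ} {k : Tan v → ℤ} {l : Nor v →₀ ℤ} (h : Conserving k l)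
    (hk : k ≠ 0) (hl : norNorm l ≤ 2) : 2 ≤ tanNorm k := by
  by_contra hlt
  have h1 : tanNorm k = 1 := by
    have : tanNorm k ≠ 0 := fun e => hk (tanNorm_eq_zero.mp e)
    omega
  obtain ⟨m, hm⟩ := Function.ne_iff.mp hk
  have hm' : k m ≠ 0 := hm
  rw [tanNorm, ← Finset.add_sum_erase _ _ (Finset.mem_univ m)] at h1
  have hz : ∑ j ∈ Finset.univ.erase m, (k j).natAbs = 0 := by omega
  have hoff : ∀ j, j ≠ m → k j = 0 := fun j hj =>
    Int.natAbs_eq_zero.mp (Finset.sum_eq_zero_iff.mp hz j (by simp [hj]))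
  have hmass := h.mass
  have hmom := h.1
  rw [Finset.sum_eq_single m (fun j _ hj => hoff j hj) (by simp)] at hmass
  rw [Finset.sum_eq_single m (fun j _ hj => by rw [hoff j hj, mul_zero]) (by simp)] at hmom
  have hkm : k m = 1 ∨ k m = -1 := by omega
  rcases norNorm_le_two_cases hl with rfl | ⟨a, -, c, hc, rfl⟩ | ⟨a, -, b, -, c, d, hc, hd, rfl⟩
  · simp at hmass
    exact hm' hmass
  · rw [sum_single_mul (fun _ => 1)] at hmass
    rw [sum_single_mul (fun j => ((j : ZBar) : ℤ))] at hmom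
    have hc' : c = - k m := by omega
    rw [hc', mul_neg, ← sub_eq_add_neg, ← sub_mul] at hmom
    -- Mass makes the two signs opposite, so momentum makes the two sites equal; but one is
    -- tangential and the other normal.
    have : ((m : ZBar) : ℤ) = (a : ZBar) := by
      rcases mul_eq_zero.mp hmom with h0 | h0
      · omega
      · exact absurd h0 hm'
    exact a.2 (Subtype.ext this ▸ m.2)
  -- Parity: a sum of three signs is odd and cannot vanish.
  · rw [sum_add_mul (fun _ => 1), sum_single_mul (fun _ => 1), sum_single_mul (fun _ => 1)]
      at hmass
    omega

lemma abs_sum_val_mul_le {v : ℕ} (k : Tan v → ℤ) :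
    |∑ j : Tan v, ((j : ZBar) : ℤ) * k j| ≤ v * tanNorm k := by
  rw [tanNorm, Nat.cast_sum, Finset.mul_sum]
  refine (Finset.abs_sum_le_sum_abs _ _).trans (Finset.sum_le_sum fun j _ => ?_)
  rw [abs_mul, Int.natCast_natAbs]
  have : |((j : ZBar) : ℤ)| ≤ v := by exact_mod_cast mem_sites.mp j.2
  gcongr

/-- For distinct integers $|a-b|\ge1$, so $|a+b|\le|a^2-b^2|\le N$, and $a$ is the mean of $a+b$ and
$a-b$. -/
lemma abs_le_of_mul_bounds {a b N : ℤ} (hab : a ≠ b) (h1 : |a - b| ≤ N)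
    (h2 : |a ^ 2 - b ^ 2| ≤ N) : |a| ≤ N := by
  have h3 : |a + b| ≤ N := by
    refine le_trans ?_ h2
    rw [sq_sub_sq, abs_mul]
    exact le_mul_of_one_le_right (abs_nonneg _) (Int.one_le_abs (sub_ne_zero.mpr hab))
  rw [abs_le] at *
  constructor <;> linarith

/-- The conservation laws and a bound on the normal part of the divisor confine `l`. -/
lemma Conserving.abs_le_of_mem_support {v : ℕ} {k : Tan v → ℤ} {l : Nor v →₀ ℤ}
    (h : Conserving k l) (hl : norNorm l ≤ 2) {N : ℕ} (hN : v * tanNorm k ≤ N)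
    (hQ : norBracket l ≤ N) {j : Nor v} (hj : j ∈ l.support) : |((j : ZBar) : ℤ)| ≤ N := by
  have hN' : (v : ℤ) * tanNorm k ≤ N := by exact_mod_cast hN
  have hmom : |l.sum (fun j c => ((j : ZBar) : ℤ) * c)| ≤ N := by
    rw [eq_neg_of_add_eq_zero_right h.1, abs_neg]
    exact (abs_sum_val_mul_le k).trans hN'
  have hq : |l.sum (fun j c => ((j : ZBar) : ℤ) ^ 2 * c)| ≤ N := by
    have h1 := (le_max_right _ _).trans hQ
    rw [Finsupp.sum] at h1 ⊢
    simp only [norVal] at h1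
    exact_mod_cast h1
  have hsq : ∀ a b : ℤ, a ^ 2 + b ^ 2 ≤ N → |a| ≤ N := fun a b hab => by
    have : |a| ≤ a ^ 2 := by
      rw [← sq_abs]
      rcases eq_or_ne a 0 with rfl | ha
      · simp
      · nlinarith [Int.one_le_abs ha]
    nlinarith [sq_nonneg b]
  rcases norNorm_le_two_cases hl with rfl | ⟨a, -, c, hc, rfl⟩ | ⟨a, ha, b, hb, c, d, hc, hd, e⟩
  · simp at hj
  · rw [sum_single_mul (fun j => ((j : ZBar) : ℤ))] at hmom
    have : j = a := by
      by_contra hne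
      simp [Ne.symm hne] at hj
    subst this
    rcases hc with rfl | rfl <;> simpa using hmom
  -- Opposite signs at the same site would cancel, contradicting that `a` lies in the support of
  -- `l`.
  · have hne : c = -d → ((a : ZBar) : ℤ) ≠ (b : ZBar) := by
      rintro hcd hab
      have : a = b := Subtype.ext (Subtype.ext hab)
      rw [e, this, hcd, ← Finsupp.single_add] at ha
      simp at ha
    have hjab : j = a ∨ j = b := by
      by_contra hcon
      rw [not_or] at hcon
      rw [e] at hj
      simp [Ne.symm hcon.1, Ne.symm hcon.2] at hj
    rw [e, sum_add_mul (fun j => ((j : ZBar) : ℤ)), sum_single_mul (fun j => ((j : ZBar) : ℤ)),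
      sum_single_mul (fun j => ((j : ZBar) : ℤ))] at hmom
    rw [e, sum_add_mul (fun j => ((j : ZBar) : ℤ) ^ 2),
      sum_single_mul (fun j => ((j : ZBar) : ℤ) ^ 2),
      sum_single_mul (fun j => ((j : ZBar) : ℤ) ^ 2)] at hq
    have hxy : |((a : ZBar) : ℤ)| ≤ N ∧ |((b : ZBar) : ℤ)| ≤ N := by
      generalize ((a : ZBar) : ℤ) = x at hmom hq hne ⊢
      generalize ((b : ZBar) : ℤ) = y at hmom hq hne ⊢
      -- For equal signs the quadratic bound alone confines both sites; for opposite signs momentum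
      -- bounds $x-y$ and the quadratic bound then controls $x+y$.
      have same : |x ^ 2 + y ^ 2| ≤ N → |x| ≤ N ∧ |y| ≤ N := fun hs =>
        ⟨hsq x y ((le_abs_self _).trans hs),
          hsq y x (by rw [add_comm]; exact (le_abs_self _).trans hs)⟩
      have opposite : x ≠ y → |x - y| ≤ N → |x ^ 2 - y ^ 2| ≤ N → |x| ≤ N ∧ |y| ≤ N :=
        fun hn h1 h2 => ⟨abs_le_of_mul_bounds hn h1 h2,
          abs_le_of_mul_bounds hn.symm (by rwa [abs_sub_comm]) (by rwa [abs_sub_comm])⟩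
      rcases hc with rfl | rfl <;> rcases hd with rfl | rfl
      · exact same (by simpa using hq)
      · exact opposite (hne rfl) (by simpa [sub_eq_add_neg] using hmom)
          (by simpa [sub_eq_add_neg] using hq)
      · refine opposite (hne rfl) ?_ ?_
        · rw [abs_sub_comm]
          convert hmom using 2
          ring
        · rw [abs_sub_comm]
          convert hq using 2
          ring
      · refine same ?_
        rw [← abs_neg]
        convert hq using 2
        ring
    rcases hjab with rfl | rfl
    exacts [hxy.1, hxy.2]

/-! ### Counting resonance indices. -/

/-- The zero vector and the signed unit vectors at the normal sites of modulus at most `N`. -/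
noncomputable def signedUnits (v N : ℕ) : Finset (Nor v →₀ ℤ) :=
  open Classical in
  insert 0 ((((sites N).subtype (fun j => j ∉ sites v)) ×ˢ ({1, -1} : Finset ℤ)).image
    fun p => Finsupp.single p.1 p.2)

lemma card_sites_le (N : ℕ) : (sites N).card ≤ 2 * N + 1 := by
  rw [sites, Finset.card_subtype]
  refine (Finset.card_filter_le _ _).trans ?_
  rw [Int.card_Icc]
  omega

lemma card_signedUnits_le (v N : ℕ) : (signedUnits v N).card ≤ 4 * N + 3 := by
  classical
  have h1 : ((sites N).subtype (fun j => j ∉ sites v)).card ≤ 2 * N + 1 := by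
    rw [Finset.card_subtype]
    exact (Finset.card_filter_le _ _).trans (card_sites_le N)
  have h2 : (({1, -1} : Finset ℤ)).card = 2 := rfl
  unfold signedUnits
  refine (Finset.card_insert_le _ _).trans ?_
  have := (Finset.card_image_le (s := ((sites N).subtype (fun j => j ∉ sites v)) ×ˢ
    ({1, -1} : Finset ℤ)) (f := fun p => Finsupp.single p.1 p.2))
  rw [Finset.card_product, h2] at this
  omega

lemma mem_signedUnits {v N : ℕ} {a : Nor v} {c : ℤ} (ha : |((a : ZBar) : ℤ)| ≤ N)
    (hc : c = 1 ∨ c = -1) : Finsupp.single a c ∈ signedUnits v N := by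
  classical
  have : (a : ZBar) ∈ sites N := mem_sites.mpr (by exact_mod_cast ha)
  refine Finset.mem_insert_of_mem (Finset.mem_image.mpr ⟨(a, c), ?_, rfl⟩)
  simp [this, hc]

open scoped Pointwise in
/-- The sums of two signed unit vectors, including all normal indices of length at most two. -/
noncomputable def shortIndices (v N : ℕ) : Finset (Nor v →₀ ℤ) :=
  open Classical in signedUnits v N + signedUnits v N

lemma card_shortIndices_le (v N : ℕ) : (shortIndices v N).card ≤ (4 * N + 3) ^ 2 := by
  classical
  unfold shortIndices
  refine Finset.card_add_le.trans ?_
  rw [sq]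
  exact Nat.mul_le_mul (card_signedUnits_le v N) (card_signedUnits_le v N)

lemma mem_shortIndices {v N : ℕ} {l : Nor v →₀ ℤ} (hl : norNorm l ≤ 2)
    (h : ∀ j ∈ l.support, |((j : ZBar) : ℤ)| ≤ N) : l ∈ shortIndices v N := by
  classical
  have h0 : (0 : Nor v →₀ ℤ) ∈ signedUnits v N := Finset.mem_insert_self _ _
  unfold shortIndices
  rcases norNorm_le_two_cases hl with rfl | ⟨a, ha, c, hc, e⟩ | ⟨a, ha, b, hb, c, d, hc, hd, e⟩
  · exact Finset.mem_add.mpr ⟨0, h0, 0, h0, add_zero _⟩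
  · exact Finset.mem_add.mpr ⟨_, mem_signedUnits (h a ha) hc, 0, h0, by rw [add_zero, ← e]⟩
  · exact Finset.mem_add.mpr ⟨_, mem_signedUnits (h a ha) hc, _, mem_signedUnits (h b hb) hd,
      e.symm⟩

/-- The tangential indices supported on `J_i` with entries at most `n`. -/
noncomputable def tanBox (v i n : ℕ) : Finset (Tan v → ℤ) :=
  Fintype.piFinset fun j => if (j : ZBar) ∈ sites i then Finset.Icc (-(n : ℤ)) n else {0}

lemma card_tanBox_le (v i n : ℕ) : (tanBox v i n).card ≤ (2 * n + 1) ^ (2 * i + 1) := by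
  have hcard : ∀ j : Tan v,
      (if (j : ZBar) ∈ sites i then Finset.Icc (-(n : ℤ)) n else {0}).card =
        if (j : ZBar) ∈ sites i then 2 * n + 1 else 1 := by
    intro j
    split_ifs
    · rw [Int.card_Icc]; omega
    · rfl
  rw [tanBox, Fintype.card_piFinset, Finset.prod_congr rfl fun j _ => hcard j,
    Finset.prod_ite, Finset.prod_const, Finset.prod_const_one, mul_one]
  refine Nat.pow_le_pow_right (by omega) (le_trans ?_ (card_sites_le i))
  exact Finset.card_le_card_of_injOn (fun j => (j : ZBar))
    (fun j hj => (Finset.mem_filter.mp hj).2) (Subtype.val_injective.injOn)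

lemma mem_tanBox {v i n : ℕ} {k : Tan v → ℤ} (hi : SupportedOn i k) (hn : tanNorm k = n) :
    k ∈ tanBox v i n := by
  refine Fintype.mem_piFinset.mpr fun j => ?_
  split_ifs with h
  · have : (k j).natAbs ≤ n := hn ▸ Finset.single_le_sum (f := fun j => (k j).natAbs)
      (fun _ _ => Nat.zero_le _) (Finset.mem_univ j)
    rw [Finset.mem_Icc]
    omega
  · simpa using hi j h

/-- On the sites $\pm1$, momentum and mass read $k_1-k_{-1}=0$ and $k_1+k_{-1}=0$. This removes the
levels $i\le1$, to which `absorb_le_pow_self` does not apply. -/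
lemma eq_zero_of_supportedOn_one {v i : ℕ} (hi : i ≤ 1) {k : Tan v → ℤ} (hs : SupportedOn i k)
    (h : Conserving k 0) : k = 0 := by
  have hoff : ∀ j : Tan v, ((j : ZBar) : ℤ) ≠ 1 → ((j : ZBar) : ℤ) ≠ -1 → k j = 0 := by
    intro j h1 h2
    refine hs j fun hmem => ?_
    have h3 : |((j : ZBar) : ℤ)| ≤ i := by exact_mod_cast mem_sites.mp hmem
    have h4 := (j : ZBar).2
    rw [abs_le] at h3
    omega
  obtain ⟨hmom, hmass⟩ := h
  simp only [Finsupp.sum_zero_index, add_zero] at hmom hmass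
  have hinj : ∀ i j : Tan v, ((i : ZBar) : ℤ) = (j : ZBar) → i = j :=
    fun i j e => Subtype.ext (Subtype.ext e)
  have key : ∀ c : ℤ, (c = 1 ∨ c = -1) → ∀ j : Tan v, ((j : ZBar) : ℤ) = c → k j = 0 := by
    intro c hc j hj
    -- Momentum plus $c$ times mass kills the site $-c$ and leaves $2c$ times the entry at $c$.
    have hsum : ∑ i : Tan v, (((i : ZBar) : ℤ) + c) * k i = 0 := by
      simp only [add_mul, Finset.sum_add_distrib, ← Finset.mul_sum]
      rw [hmom, hmass, mul_zero, add_zero]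
    rw [Finset.sum_eq_single j] at hsum
    · rcases mul_eq_zero.mp hsum with h0 | h0
      · omega
      · exact h0
    · intro i _ hij
      by_cases hi' : ((i : ZBar) : ℤ) = -c
      · rw [hi', neg_add_cancel, zero_mul]
      · have hi'' : ((i : ZBar) : ℤ) ≠ c := fun e => hij (hinj i j (e.trans hj.symm))
        rw [hoff i (by omega) (by omega), mul_zero]
    · simp
  ext j
  by_cases h1 : ((j : ZBar) : ℤ) = 1
  · exact key 1 (Or.inl rfl) j h1
  by_cases h2 : ((j : ZBar) : ℤ) = -1
  · exact key (-1) (Or.inr rfl) j h2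
  exact hoff j h1 h2

/-! ### Union bound and absorption of constants. -/

lemma tsum_one_div_succ_sq_le : ∑' n : ℕ, 1 / ((n + 1 : ℕ) : ℝ) ^ 2 ≤ 2 := by
  refine Real.tsum_le_of_sum_range_le (fun n => by positivity) fun n => ?_
  rw [Finset.range_eq_Ico, Finset.sum_Ico_add' (fun i : ℕ => 1 / (i : ℝ) ^ 2) 0 n 1]
  exact sum_inv_sq_le n

/-- A union bound over finite families whose total measure decays quadratically. -/
lemma measure_le_of_quadratic_decay {Ω X : Type*} [MeasurableSpace Ω] (μ : Measure Ω)
    {A : Set Ω} (T : ℕ → Finset X) (R : ℕ → X → Set Ω) (r : ℕ → ℝ) {D : ℝ} (hD : 0 ≤ D)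
    (hA : ∀ σ ∈ A, ∃ n, 1 ≤ n ∧ ∃ x ∈ T n, σ ∈ R n x)
    (hR : ∀ n, 1 ≤ n → ∀ x ∈ T n, μ (R n x) ≤ ENNReal.ofReal (r n))
    (hr : ∀ n, 1 ≤ n → (T n).card * r n ≤ D / (n : ℝ) ^ 2) :
    μ A ≤ ENNReal.ofReal (2 * D) := by
  have hsum : Summable fun n : ℕ => 1 / ((n + 1 : ℕ) : ℝ) ^ 2 :=
    (summable_nat_add_iff 1).mpr (Real.summable_one_div_nat_pow.mpr (by norm_num : 1 < 2))
  calc μ A ≤ μ (⋃ n : ℕ, ⋃ x ∈ T (n + 1), R (n + 1) x) := by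
        refine measure_mono fun σ hσ => ?_
        obtain ⟨n, hn, x, hx, hσx⟩ := hA σ hσ
        obtain ⟨m, rfl⟩ := Nat.exists_eq_add_of_le' hn
        exact Set.mem_iUnion.mpr ⟨m, Set.mem_iUnion₂.mpr ⟨x, hx, hσx⟩⟩
    _ ≤ ∑' n : ℕ, μ (⋃ x ∈ T (n + 1), R (n + 1) x) := measure_iUnion_le _
    _ ≤ ∑' n : ℕ, ENNReal.ofReal (D * (1 / ((n + 1 : ℕ) : ℝ) ^ 2)) := by
        refine ENNReal.tsum_le_tsum fun n => ?_
        calc _ ≤ ∑ x ∈ T (n + 1), μ (R (n + 1) x) := measure_biUnion_finset_le _ _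
          _ ≤ ∑ _x ∈ T (n + 1), ENNReal.ofReal (r (n + 1)) :=
              Finset.sum_le_sum fun x hx => hR _ (by omega) x hx
          _ = ENNReal.ofReal ((T (n + 1)).card * r (n + 1)) := by
              rw [Finset.sum_const, nsmul_eq_mul, ENNReal.ofReal_mul (Nat.cast_nonneg _),
                ENNReal.ofReal_natCast]
          _ ≤ _ := by
              refine ENNReal.ofReal_le_ofReal ((hr _ (by omega)).trans_eq ?_)
              rw [mul_one_div]
    _ = ENNReal.ofReal (D * ∑' n : ℕ, 1 / ((n + 1 : ℕ) : ℝ) ^ 2) := by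
        rw [← tsum_mul_left, ENNReal.ofReal_tsum_of_nonneg (fun n => by positivity)
          (hsum.mul_left D)]
    _ ≤ _ := by
        refine ENNReal.ofReal_le_ofReal ?_
        have := mul_le_mul_of_nonneg_left tsum_one_div_succ_sq_le hD
        linarith

lemma alpha_pos (A : ℝ) (v i : ℕ) : 0 < alpha A v i := by
  have : (0 : ℝ) < (i : ℝ) ^ i := by
    rcases Nat.eq_zero_or_pos i with rfl | h
    · simp
    · positivity
  unfold alpha
  have := Real.rpow_pos_of_pos this A
  positivity

lemma one_le_pow_self (i : ℕ) : (1 : ℝ) ≤ (i : ℝ) ^ i := by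
  rcases Nat.eq_zero_or_pos i with rfl | h
  · simp
  · exact one_le_pow₀ (by exact_mod_cast h)

lemma beta_pos (B : ℝ) (v : ℕ) : 0 < beta B v :=
  one_div_pos.mpr (Real.rpow_pos_of_pos (zero_lt_one.trans_le (one_le_pow_self v)) B)

lemma beta_le_one {B : ℝ} (hB : 0 < B) (v : ℕ) : beta B v ≤ 1 := by
  rw [beta, one_div]
  exact inv_le_one_of_one_le₀ (Real.one_le_rpow (one_le_pow_self v) hB.le)

lemma alpha_le_one {A : ℝ} (hA : 0 < A) (v i : ℕ) : alpha A v i ≤ 1 := by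
  have h1 : 1 / ((i : ℝ) ^ i) ^ A ≤ 1 := beta_le_one hA i
  have h2 : (1 : ℝ) / 2 ^ v ≤ 1 := by
    rw [one_div]; exact inv_le_one_of_one_le₀ (one_le_pow₀ (by norm_num))
  have h3 : (0 : ℝ) ≤ 1 / 2 ^ v := by positivity
  have h4 : 0 < 1 / ((i : ℝ) ^ i) ^ A := beta_pos A i
  unfold alpha
  nlinarith

/-- The truncation in a resonance zone keeps the tangential sites. -/
lemma lt_cutoff {i τ n : ℕ} (hn : 2 ≤ n) (hτ : i ≤ 2 * τ + 2) {α : ℝ} (h0 : 0 < α)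
    (h1 : α ≤ 1) : (i : ℝ) < (n : ℝ) ^ (2 * τ + 2) / α ^ 2 := by
  have h2 : (i : ℝ) < (2 : ℝ) ^ i := by exact_mod_cast Nat.lt_two_pow_self
  calc (i : ℝ) < 2 ^ i := h2
    _ ≤ 2 ^ (2 * τ + 2) := pow_le_pow_right₀ (by norm_num) hτ
    _ ≤ (n : ℝ) ^ (2 * τ + 2) := pow_le_pow_left₀ (by norm_num) (by exact_mod_cast hn) _
    _ ≤ _ := by
      rw [le_div_iff₀ (by positivity)]
      exact mul_le_of_le_one_right (by positivity) (pow_le_one₀ h0.le h1)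

/-- Factors that grow at most exponentially are absorbed by a power of `i ^ i`. -/
lemma absorb_le_pow_self {i : ℕ} (hi : 2 ≤ i) :
    (2 : ℝ) ^ 22 * i ^ 7 * 9 ^ i ≤ ((i : ℝ) ^ i) ^ (40 : ℝ) := by
  have hi' : (2 : ℝ) ≤ i := by exact_mod_cast hi
  have hi1 : (1 : ℝ) ≤ i := by linarith
  have h1 : (2 : ℝ) ^ 22 ≤ (i : ℝ) ^ (11 * i) :=
    (pow_le_pow_left₀ (by norm_num) hi' 22).trans (pow_le_pow_right₀ hi1 (by omega))
  have h2 : (i : ℝ) ^ 7 ≤ (i : ℝ) ^ (4 * i) := pow_le_pow_right₀ hi1 (by omega)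
  have h3 : (9 : ℝ) ^ i ≤ (i : ℝ) ^ (4 * i) := by
    rw [pow_mul]
    refine pow_le_pow_left₀ (by norm_num) ?_ i
    calc (9 : ℝ) ≤ 2 ^ 4 := by norm_num
      _ ≤ _ := pow_le_pow_left₀ (by norm_num) hi' 4
  calc (2 : ℝ) ^ 22 * i ^ 7 * 9 ^ i
      ≤ (i : ℝ) ^ (11 * i) * (i : ℝ) ^ (4 * i) * (i : ℝ) ^ (4 * i) := by gcongr
    _ = (i : ℝ) ^ (19 * i) := by rw [← pow_add, ← pow_add]; congr 1; ring
    _ ≤ (i : ℝ) ^ (i * 40) := pow_le_pow_right₀ hi1 (by omega)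
    _ = ((i : ℝ) ^ i) ^ (40 : ℝ) := by
      rw [show (40 : ℝ) = ((40 : ℕ) : ℝ) by norm_num, Real.rpow_natCast, pow_mul]

lemma card_tanBox_le_real (v i : ℕ) {n : ℕ} (hn : 1 ≤ n) :
    ((tanBox v i n).card : ℝ) ≤ 3 * 9 ^ i * (n : ℝ) ^ (2 * i + 1) := by
  have h : ((tanBox v i n).card : ℝ) ≤ ((2 * n + 1 : ℕ) : ℝ) ^ (2 * i + 1) := by
    exact_mod_cast card_tanBox_le v i n
  have hn' : (1 : ℝ) ≤ n := by exact_mod_cast hn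
  calc _ ≤ _ := h
    _ ≤ (3 * (n : ℝ)) ^ (2 * i + 1) := by
      refine pow_le_pow_left₀ (by positivity) ?_ _
      push_cast
      linarith
    _ = _ := by
      rw [mul_pow, pow_succ 3, pow_mul, show (3 : ℝ) ^ 2 = 9 by norm_num]
      ring

lemma norBracket_zero {v : ℕ} : norBracket (0 : Nor v →₀ ℤ) = 1 := by
  simp [norBracket]

lemma norNorm_zero {v : ℕ} : norNorm (0 : Nor v →₀ ℤ) = 0 := by
  simp [norNorm]

lemma tanBracket_eq {v : ℕ} {k : Tan v → ℤ} (h : 1 ≤ tanNorm k) : tanBracket k = tanNorm k :=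
  max_eq_right (by exact_mod_cast h)

/-! ### Measure of the two resonance sets. -/

namespace Frequencies.AveragedAsymptotics

variable {v : ℕ} {F : Frequencies v} {E ρ : ℝ} {b t : Param → ℝ} {H : ZBar → Param → ℝ}

/-- The low-order resonances of the indices supported on `J_i`. -/
lemma prodMeasure_lowRes_level_le (hF : F.AveragedAsymptotics E ρ b t H) (hE : 0 ≤ E)
    (hρ : 0 < ρ) {M : ℝ}
    (hM : ∀ m : ZBar, ∑ j : Tan v, |m.val| / |(j : ZBar).val| * kernel ρ j m ≤ M)
    (hEM : E * (M + 6) ≤ 1 / 2) {S : Set Param} (hS : S ⊆ paramBox) {i : ℕ} (hi : 2 ≤ i)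
    {α : ℝ} (hα : 0 < α) (hα1 : α ≤ 1) {N : ℕ} (hN : 1 ≤ N) :
    prodMeasure {σ | ∃ k : Tan v → ℤ, SupportedOn i k ∧ N < tanNorm k ∧ Conserving k 0 ∧
      σ ∈ F.resZone S k 0 α (tau i)} ≤
      ENNReal.ofReal (1 / (N : ℝ) * (((i : ℝ) ^ i) ^ (40 : ℝ) * α)) := by
  -- Layers are $|k|=n$. The side conditions sit inside the sets, so superfluous members of the box
  -- contribute the empty set. In `D`, $24=3\cdot8$ combines the counting constant with the zone
  -- constant.
  refine (measure_le_of_quadratic_decay prodMeasure (tanBox v i)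
    (fun n k => {σ | (SupportedOn i k ∧ N < tanNorm k ∧ Conserving k 0 ∧ tanNorm k = n) ∧
      σ ∈ F.resZone S k 0 α (tau i)})
    (fun n => if N < n then i * (8 * α * (1 / (n : ℝ) ^ tau i)) else 0)
    (D := 24 * 9 ^ i * i * α / N) (by positivity) ?_ ?_ ?_).trans
    (ENNReal.ofReal_le_ofReal ?_)
  · rintro σ ⟨k, h1, h2, h3, h4⟩
    exact ⟨tanNorm k, by omega, k, mem_tanBox h1 rfl, ⟨h1, h2, h3, rfl⟩, h4⟩
  · intro n _ k _
    by_cases hc : SupportedOn i k ∧ N < tanNorm k ∧ Conserving k 0 ∧ tanNorm k = n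
    · obtain ⟨h1, h2, h3, h4⟩ := hc
      have hk : k ≠ 0 := fun e => by rw [tanNorm_eq_zero.mpr e] at h2; omega
      have hbr : tanBracket k = n := by rw [tanBracket_eq (by omega), h4]
      have := hF.prodMeasure_resZone_le hE hρ hM hEM hk (by rw [norNorm_zero]; omega) h3 h1 hα
        (τ := tau i) (by rw [hbr]; exact lt_cutoff (by omega) (by unfold tau; omega) hα hα1) hS
      rw [hbr, norBracket_zero] at this
      rw [if_pos (by omega)]
      exact (measure_mono fun σ hσ => hσ.2).trans this
    · simp [hc]
  · intro n hn
    have hn' : (1 : ℝ) ≤ n := by exact_mod_cast hn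
    split_ifs with hNn
    · have hNn' : (N : ℝ) ≤ n := by exact_mod_cast hNn.le
      have hN' : (0 : ℝ) < N := by exact_mod_cast hN
      -- One power of $n>N$ pays for the gain $1/N$ and two pay for summability; in all
      -- $2i+4\le\tau_i$.
      have hpow : (n : ℝ) ^ (2 * i + 1) * N * (n : ℝ) ^ 2 ≤ (n : ℝ) ^ tau i := by
        calc _ ≤ (n : ℝ) ^ (2 * i + 1) * n * (n : ℝ) ^ 2 := by gcongr
          _ = (n : ℝ) ^ (2 * i + 4) := by rw [← pow_succ, ← pow_add]
          _ ≤ _ := pow_le_pow_right₀ hn' (by unfold tau; omega)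
      calc _ ≤ 3 * 9 ^ i * (n : ℝ) ^ (2 * i + 1) * (i * (8 * α * (1 / (n : ℝ) ^ tau i))) := by
            gcongr
            exact card_tanBox_le_real v i hn
        _ = 24 * 9 ^ i * i * α * ((n : ℝ) ^ (2 * i + 1) / (n : ℝ) ^ tau i) := by ring
        _ ≤ 24 * 9 ^ i * i * α * (1 / (N * (n : ℝ) ^ 2)) := by
            gcongr 24 * 9 ^ i * i * α * ?_
            rw [div_le_div_iff₀ (by positivity) (by positivity)]
            linarith
        _ = _ := by field_simp
    · rw [mul_zero]
      positivity
  · have hi1 : (1 : ℝ) ≤ i := by exact_mod_cast (by omega : 1 ≤ i)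
    have h1 : 2 * (24 * 9 ^ i * (i : ℝ)) ≤ ((i : ℝ) ^ i) ^ (40 : ℝ) := by
      refine le_trans ?_ (absorb_le_pow_self hi)
      have : (i : ℝ) ≤ (i : ℝ) ^ 7 := le_self_pow₀ hi1 (by norm_num)
      calc _ = 48 * (i : ℝ) * 9 ^ i := by ring
        _ ≤ _ := by gcongr; norm_num
    calc _ = 1 / (N : ℝ) * (2 * (24 * 9 ^ i * (i : ℝ)) * α) := by ring
      _ ≤ _ := by gcongr

/-- Only the levels $i\ge2$ contain resonances; the nonnegative term $i=1$ is added to reach the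
stated sum. -/
lemma prodMeasure_lowRes_le (hF : F.AveragedAsymptotics E ρ b t H) (hE : 0 ≤ E)
    (hρ : 0 < ρ) {M : ℝ}
    (hM : ∀ m : ZBar, ∑ j : Tan v, |m.val| / |(j : ZBar).val| * kernel ρ j m ≤ M)
    (hEM : E * (M + 6) ≤ 1 / 2) {S : Set Param} (hS : S ⊆ paramBox) {A : ℝ} (hA : 0 < A) :
    prodMeasure (F.lowRes S A) ≤ ENNReal.ofReal (1 / (iota v : ℝ) *
      ∑ i ∈ Finset.Icc 1 v, ((i : ℝ) ^ i) ^ (40 : ℝ) * alpha A v i) := by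
  have hι : 1 ≤ iota v := Nat.one_le_two_pow
  have hnn : ∀ i : ℕ, 0 ≤ 1 / (iota v : ℝ) * (((i : ℝ) ^ i) ^ (40 : ℝ) * alpha A v i) := fun i => by
    have := alpha_pos A v i
    positivity
  calc prodMeasure (F.lowRes S A) ≤ prodMeasure (⋃ i ∈ Finset.Icc 2 v,
        {σ | ∃ k : Tan v → ℤ, SupportedOn i k ∧ iota v < tanNorm k ∧ Conserving k 0 ∧
          σ ∈ F.resZone S k 0 (alpha A v i) (tau i)}) := by
        refine measure_mono ?_
        rintro σ ⟨i, hi, k, h1, h2, h3, h4⟩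
        refine Set.mem_iUnion₂.mpr ⟨i, ?_, k, h1, h2, h3, h4⟩
        rw [Finset.mem_Icc]
        refine ⟨?_, hi⟩
        by_contra hlt
        have hk := eq_zero_of_supportedOn_one (by omega) h1 h3
        rw [tanNorm_eq_zero.mpr hk] at h2
        omega
    _ ≤ ∑ i ∈ Finset.Icc 2 v, ENNReal.ofReal
          (1 / (iota v : ℝ) * (((i : ℝ) ^ i) ^ (40 : ℝ) * alpha A v i)) := by
        refine (measure_biUnion_finset_le _ _).trans (Finset.sum_le_sum fun i hi => ?_)
        exact hF.prodMeasure_lowRes_level_le hE hρ hM hEM hS (Finset.mem_Icc.mp hi).1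
          (alpha_pos A v i) (alpha_le_one hA v i) hι
    _ ≤ ∑ i ∈ Finset.Icc 1 v, ENNReal.ofReal
          (1 / (iota v : ℝ) * (((i : ℝ) ^ i) ^ (40 : ℝ) * alpha A v i)) :=
        Finset.sum_le_sum_of_subset (Finset.Icc_subset_Icc_left (by norm_num))
    _ = _ := by rw [← ENNReal.ofReal_sum_of_nonneg fun i _ => hnn i, ← Finset.mul_sum]

/-- Since the threshold contains $\langle l\rangle_2$, which is unbounded over $l$, it is first
bounded by $14v^2n$ on every nonempty zone with $|k|=n$. The same bound makes the set of relevant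
$l$ finite. The powers of $n$ needed are $2v+1$ for $k$, 2 for $l$, 1 for $\langle l\rangle_2$ and 2
for summability, together at most $\tau_v$. -/
lemma prodMeasure_normalRes_le_of_two_le (hF : F.AveragedAsymptotics E ρ b t H) (hE : 0 ≤ E)
    (hE1 : E ≤ 1) (hρ : 0 < ρ) {M : ℝ}
    (hM : ∀ m : ZBar, ∑ j : Tan v, |m.val| / |(j : ZBar).val| * kernel ρ j m ≤ M)
    (hEM : E * (M + 6) ≤ 1 / 2) {S : Set Param} (hS : S ⊆ paramBox) {B : ℝ} (hB : 0 < B)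
    (hv : 2 ≤ v) :
    prodMeasure (F.normalRes S B) ≤
      ENNReal.ofReal (((v : ℝ) ^ v) ^ (40 : ℝ) * beta B v) := by
  have hβ := beta_pos B v
  have hβ1 := beta_le_one hB v
  have hv1 : (1 : ℝ) ≤ v := by exact_mod_cast (by omega : 1 ≤ v)
  have hsupp : ∀ k : Tan v → ℤ, SupportedOn v k := fun k j hj => absurd j.2 hj
  obtain ⟨N, hN⟩ : ∃ N : ℕ → ℕ, ∀ n, N n = 14 * v ^ 2 * n := ⟨_, fun _ => rfl⟩
  refine (measure_le_of_quadratic_decay prodMeasure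
    (fun n => tanBox v v n ×ˢ shortIndices v (N n))
    (fun n p => {σ | (p.1 ≠ 0 ∧ norNorm p.2 ≤ 2 ∧ Conserving p.1 p.2 ∧ tanNorm p.1 = n ∧
      norBracket p.2 ≤ 14 * v ^ 2 * n) ∧ σ ∈ F.resZone S p.1 p.2 (beta B v) (tau v)})
    (fun n => v * (8 * beta B v * (14 * v ^ 2 * n / (n : ℝ) ^ tau v)))
    -- Here $1169616=3\cdot59^2\cdot8\cdot14$, where $59=4\cdot14+3$ comes from $4N+3\le59v^2n$, and
    -- $v^7=v^4\cdot v\cdot v^2$. Twice this constant is below $2^{22}$.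
    (D := 1169616 * v ^ 7 * 9 ^ v * beta B v) (by positivity) ?_ ?_ ?_).trans
    (ENNReal.ofReal_le_ofReal ?_)
  · rintro σ ⟨k, l, hk, hl, hc, hσ⟩
    have h2 := hc.two_le_tanNorm hk hl
    have htr : truncate k (beta B v) (tau v) σ ∈ paramBox := by
      rw [truncate_eq_clampTruncate _ _ _ (hS hσ.1)]
      exact clampTruncate_mem_paramBox _ _
    have hbr := hF.norBracket_le_of_resonant hE1 (by omega) h2 hl hc hβ hβ1
      (by unfold tau; omega) htr hσ.2
    have hvk : v * tanNorm k ≤ N (tanNorm k) := by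
      rw [hN]
      exact Nat.mul_le_mul_right _ (by nlinarith)
    have hQ : norBracket l ≤ N (tanNorm k) := by
      rw [hN]
      push_cast
      exact hbr
    have hmem : l ∈ shortIndices v (N (tanNorm k)) :=
      mem_shortIndices hl fun j hj => hc.abs_le_of_mem_support hl hvk hQ hj
    exact ⟨tanNorm k, one_le_two.trans h2, (k, l),
      Finset.mem_product.mpr ⟨mem_tanBox (hsupp k) rfl, hmem⟩, ⟨hk, hl, hc, rfl, hbr⟩, hσ⟩
  · rintro n - ⟨k, l⟩ -
    by_cases hc : k ≠ 0 ∧ norNorm l ≤ 2 ∧ Conserving k l ∧ tanNorm k = n ∧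
      norBracket l ≤ 14 * v ^ 2 * n
    · obtain ⟨hk, hl, hc, hn, hbr⟩ := hc
      have h2 := hc.two_le_tanNorm hk hl
      have hkn : tanBracket k = n := by rw [tanBracket_eq (by omega), hn]
      have := hF.prodMeasure_resZone_le hE hρ hM hEM hk hl hc (hsupp k) hβ
        (τ := tau v) (by rw [hkn]; exact lt_cutoff (by omega) (by unfold tau; omega) hβ hβ1) hS
      rw [hkn] at this
      refine (measure_mono fun σ hσ => hσ.2).trans (this.trans (ENNReal.ofReal_le_ofReal ?_))
      gcongr
    · simp only [hc, false_and, Set.ofPred_false, measure_empty, zero_le]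
  · intro n hn
    have hn' : (1 : ℝ) ≤ n := by exact_mod_cast hn
    have hvn : (1 : ℝ) ≤ v ^ 2 * n := one_le_mul_of_one_le_of_one_le (one_le_pow₀ hv1) hn'
    have hcard : ((shortIndices v (N n)).card : ℝ) ≤ (59 * (v ^ 2 * n)) ^ 2 := by
      have h1 : ((shortIndices v (N n)).card : ℝ) ≤ ((4 * N n + 3 : ℕ) : ℝ) ^ 2 := by
        exact_mod_cast card_shortIndices_le v _
      refine h1.trans (pow_le_pow_left₀ (by positivity) ?_ 2)
      rw [hN]
      push_cast
      linarith
    have hpow : (n : ℝ) ^ (2 * v + 1) * n ^ 3 * n ^ 2 ≤ (n : ℝ) ^ tau v := by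
      rw [← pow_add, ← pow_add]
      exact pow_le_pow_right₀ hn' (by unfold tau; omega)
    rw [Finset.card_product, Nat.cast_mul]
    calc _ ≤ 3 * 9 ^ v * (n : ℝ) ^ (2 * v + 1) * (59 * (v ^ 2 * n)) ^ 2 *
          (v * (8 * beta B v * (14 * v ^ 2 * n / (n : ℝ) ^ tau v))) := by
          gcongr
          exact card_tanBox_le_real v v hn
      _ = 1169616 * v ^ 7 * 9 ^ v * beta B v *
          ((n : ℝ) ^ (2 * v + 1) * n ^ 3 / (n : ℝ) ^ tau v) := by ring
      _ ≤ 1169616 * v ^ 7 * 9 ^ v * beta B v * (1 / (n : ℝ) ^ 2) := by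
          gcongr 1169616 * v ^ 7 * 9 ^ v * beta B v * ?_
          rw [div_le_div_iff₀ (by positivity) (by positivity)]
          linarith
      _ = _ := by ring
  · have h1 := absorb_le_pow_self hv
    have h2 : 2 * (1169616 * (v : ℝ) ^ 7 * 9 ^ v) ≤ ((v : ℝ) ^ v) ^ (40 : ℝ) := by
      refine le_trans ?_ h1
      calc _ = 2339232 * (v : ℝ) ^ 7 * 9 ^ v := by ring
        _ ≤ _ := by gcongr; norm_num
    calc _ = 2 * (1169616 * (v : ℝ) ^ 7 * 9 ^ v) * beta B v := by ring
      _ ≤ _ := by gcongr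

end Frequencies.AveragedAsymptotics

/-- With $0^0=1$ the right-hand side equals 1 for $v\le1$, so it bounds any probability. -/
lemma prodMeasure_le_of_le_one (A : Set Param) (C B : ℝ) {v : ℕ} (hv : v ≤ 1) :
    prodMeasure A ≤ ENNReal.ofReal (((v : ℝ) ^ v) ^ C * beta B v) := by
  have hP : IsProbabilityMeasure prodMeasure := by unfold prodMeasure; infer_instance
  have hone : (v : ℝ) ^ v = 1 := by
    interval_cases v <;> simp
  rw [beta, hone, Real.one_rpow, Real.one_rpow]
  simpa using prob_le_one

end DNLS

theorem mainTheorem5 :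
    ∃ C : ℝ, 0 < C ∧ ∀ ρ₀ : ℝ, 0 < ρ₀ → ∃ εmax : ℝ, 0 < εmax ∧
      ∀ ε₀ : ℝ, 0 < ε₀ → ε₀ ≤ εmax → ∀ A B : ℝ, 0 < A → 0 < B →
        ∀ (v : ℕ) (F : DNLS.Frequencies v), F.HasAsymptotics ε₀ ρ₀ →
          ∀ S : Set DNLS.Param, S ⊆ DNLS.paramBox →
            DNLS.prodMeasure (F.lowRes S A) ≤
                ENNReal.ofReal (1 / (DNLS.iota v : ℝ) *
                  ∑ i ∈ Finset.Icc 1 v, ((i : ℝ) ^ i) ^ C * DNLS.alpha A v i) ∧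
              DNLS.prodMeasure (F.normalRes S B) ≤
                ENNReal.ofReal (((v : ℝ) ^ v) ^ C * DNLS.beta B v) := by
  refine ⟨40, by norm_num, fun ρ₀ hρ => ?_⟩
  obtain ⟨M, hM0, hM⟩ := DNLS.exists_weighted_kernel_bound hρ
  -- The bound $1/16$ gives $E=\sum\epsilon_i\le2\epsilon_0$, hence also $E\le1$; the other bound
  -- then gives $E(M+6)\le1/2$. Since `M` depends only on $\rho_0$, so does the threshold.
  refine ⟨min (1 / 16) (1 / (4 * (M + 6))), by positivity,
    fun ε₀ hε hεmax A B hA hB v F hF S hS => ?_⟩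
  obtain ⟨b, t, H, hav⟩ := hF.averaged hε hρ
  have h16 := hεmax.trans (min_le_left _ _)
  have hE := DNLS.sum_eps_le hε h16 (v + 1)
  have hE0 : 0 ≤ ∑ i ∈ Finset.range (v + 1), DNLS.eps ε₀ i :=
    Finset.sum_nonneg fun i _ => (DNLS.eps_pos hε i).le
  have hEM : (∑ i ∈ Finset.range (v + 1), DNLS.eps ε₀ i) * (M + 6) ≤ 1 / 2 := by
    have h1 := hεmax.trans (min_le_right _ _)
    rw [le_div_iff₀ (by positivity)] at h1
    nlinarith
  refine ⟨hav.prodMeasure_lowRes_le hE0 hρ (hM v) hEM hS hA, ?_⟩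
  rcases Nat.lt_or_ge v 2 with hv | hv
  · exact DNLS.prodMeasure_le_of_le_one _ _ _ (by omega)
  · exact hav.prodMeasure_normalRes_le_of_two_le hE0 (by linarith) hρ (hM v) hEM hS hB hv
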